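/- **Setting.** Let $D$ be a diagram of an oriented link $L$, with $p$ positive and $n$ negative crossings. A Kauffman state $s$ labels each crossing with $A$ or $B$; smoothing accordingly gives a set $sD$ of $|sD|$ disjoint circles, together with one scar (short chord) at each crossing, blue for $A$ and red for $B$. A scar is a bichord of $sD$ if it joins two different circles. An enhanced state is a Kauffman state $s$ with a sign $\pm$ on each circle of $sD$; its degrees are $i(s)=$ the number of $B$-labels and $j(s)=i(s)+\theta(s)$, where $\theta(s)$ is the number of $+$ circles minus the number of $-$ circles. $C^{i,j}(D)$ is the free abelian group on the enhanced states of degrees $i,j$, with differential $d(s)=\sum_t i(s,t)\,t$. Here $i(s,t)=(-1)^m$ if $t$ has the labels of $s$ except that one crossing $x$ changes from $A$ to $B$, $j(t)=j(s)$, and the common circles of $s$ and $t$ have the same signs, where $m$ is the number of $B$-labels of $s$ at crossings before $x$ in a fixed order of the crossings; otherwise $i(s,t)=0$. Let $\underline{Kh}^{i,j}(D)=\ker d_i/\operatorname{im} d_{i-1}$, and $Kh^{h,q}(L)=\underline{Kh}^{i,j}(D)$ with $i=h+n$, $j=q-p+2n$. A (blue) ladder of $sD$ of height $h\ge 1$ is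 a maximal disc that contains exactly two arcs of circles of $sD$ and $h$ parallel blue scars, its steps, joining the two arcs. Cut all the ladders of $sD$, joining the two upper ends of each ladder, and its two lower ends; the periphery number of a ladder is the number (one or two) of circles of the result that touch the extremes of this ladder. Let $s_0$ be a Kauffman state such that all blue scars of $s_0D$ are grouped into $k$ ladders $H_1,\dots,H_k$ of heights $h_1,\dots,h_k$. Order the crossings so that those of $H_1$ come first, then those of $H_2$, and so on, in each ladder in the order of its steps from top to bottom, and finally the remaining crossings. Given $0<\nu_l\le h_l$ for all $l$, let $s(\nu_1,\dots,\nu_k;C_i^{0-})$ be the sum, over all choices of $\nu_l$ steps in each $H_l$, of the following enhanced state: the Kauffman state obtained from $s_0$ by changing the chosen steps into red, with sign $-$ on the circle $C_i^0$ that touches the first red step of $H_i$ from above, and sign $+$ on all other circles. **Theorem.** Let $s_0$ be a Kauffman state of $D$ such that all blue scars of $s_0D$ are grouped into $k$ ladders $H_i$ of heights $h_i\ge 2$. Suppose that 1. all the ladders have periphery number one; 2. some ladder $H_l$ has height $h_l\ge 3$; 3. all the red scars of $s_0D$ become bichords in $s_1D$, where $s_1$ is obtained from $s_0$ by changing into red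 one blue step of each ladder. Then some group $Kh^{h,q}(L)$ contains an element of order two. Precisely, let $\mu_1,\dots,\mu_k$ be integers with $2\le\mu_i\le h_i$ for all $i$, such that $\mu_r$ is even and $\mu_r<h_r$ for some $r$. Then the chain $$V(\mu_1,\dots,\mu_k)=\sum_{\substack{1\le i\le k\\ \mu_i \text{ even},\ \mu_i<h_i}}(-1)^{\mu_1+\dots+\mu_{i-1}}\,s(\dots,\mu_{i-1},1+\mu_i,\mu_{i+1},\dots;C_i^{0-})$$ is a cycle, and its class has order exactly two in $\underline{Kh}^{i,j}(D)$, where $i=i_0+1+\sum_{l=1}^k\mu_l$ and $j=i_0+|s_1D|+2\sum_{l=1}^k\mu_l-k$, with $i_0$ the number of red scars of $s_0D$. -/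

import Mathlib

open Relation

/-! # Link diagrams, Viro's Khovanov complex, and ladders of Kauffman states -/

namespace KhovanovLadders

/-! ## Link diagrams -/

/-- The four ends of strands at each crossing `x` are `(x, 0), (x, 1), (x, 2), (x, 3)`, listed
counterclockwise; `(x, 0)` and `(x, 2)` are the ends of the under-strand, `(x, 1)` and `(x, 3)`
those of the over-strand. -/
abbrev Dart (X : Type*) := X × Fin 4

/-- The next end, counterclockwise, at the same crossing. -/
def rot {X : Type*} (d : Dart X) : Dart X := (d.1, d.2 + 1)

/-- The faces of the 4-valent graph in which the ends `d` and `edge d` are joined by an edge: the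
orbits of "follow the edge, then turn to the next end". -/
def faceSetoid {X : Type*} (edge : Dart X → Dart X) : Setoid (Dart X) :=
  EqvGen.setoid fun d d' => d' = rot (edge d)

/-- The connected components of that graph. -/
def componentSetoid {X : Type*} (edge : Dart X → Dart X) : Setoid (Dart X) :=
  EqvGen.setoid fun d d' => d' = edge d ∨ d' = rot d

/-- A link diagram with crossing set `X`, in the form of a planar diagram code: `edge` tells which
ends of strands are joined by an edge of the diagram, `freeCircles` is the number of components
without crossings. With `V = |X|` vertices and `E = 2 |X|` edges, `planar` is Euler's formula
`V - E + F = 2 · #components`, which says that every component of the graph has genus zero. -/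
structure LinkDiagram (X : Type*) where
  edge : Dart X → Dart X
  edge_edge : ∀ d, edge (edge d) = d
  edge_ne : ∀ d, edge d ≠ d
  freeCircles : ℕ
  planar : Nat.card (Quotient (faceSetoid edge)) =
    Nat.card X + 2 * Nat.card (Quotient (componentSetoid edge))

/-- The two labels of a crossing. The scar of a crossing is blue for `A` and red for `B`. -/
inductive Label
  | A
  | B
  deriving DecidableEq

instance : Fintype Label := ⟨{Label.A, Label.B}, fun x => by cases x <;> simp⟩

/-- A Kauffman state. -/
abbrev KauffmanState (X : Type*) := X → Label

/-- How the smoothing joins the four ends at a crossing. Turning the over-strand counterclockwise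
sweeps the two corners `1, 2` and `3, 0`; the `A`-smoothing opens a channel between these corners,
so it joins `0` to `1` and `2` to `3`. The `B`-smoothing joins `1` to `2` and `3` to `0`. -/
def Label.join : Label → Fin 4 → Fin 4
  | .A => ![1, 0, 3, 2]
  | .B => ![3, 2, 1, 0]

/-- The end to which `d` is joined by the smoothing of its crossing. -/
def smooth {X : Type*} (s : KauffmanState X) (d : Dart X) : Dart X := (d.1, (s d.1).join d.2)

/-- The number of `B`-labels (red scars). -/
def numRed {X : Type*} [Fintype X] (s : KauffmanState X) : ℕ :=
  (Finset.univ.filter fun x => s x = Label.B).card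

namespace LinkDiagram

variable {X : Type*}

/-- Two ends lie on the same circle of `sD`. -/
def circleSetoid (D : LinkDiagram X) (s : KauffmanState X) : Setoid (Dart X) :=
  EqvGen.setoid fun d d' => d' = D.edge d ∨ d' = smooth s d

/-- The circles of `sD`: those that pass through crossings of `D`, and the components of `D`
without crossings. -/
abbrev Circle (D : LinkDiagram X) (s : KauffmanState X) : Type _ :=
  Quotient (D.circleSetoid s) ⊕ Fin D.freeCircles

/-- The circle of `sD` through a given end. -/
def circleAt (D : LinkDiagram X) (s : KauffmanState X) (d : Dart X) : D.Circle s :=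
  Sum.inl (Quotient.mk (D.circleSetoid s) d)

/-- `|sD|`, the number of circles of `sD`. -/
noncomputable def numCircles (D : LinkDiagram X) (s : KauffmanState X) : ℕ :=
  Nat.card (D.Circle s)

/-- The scar of `x` joins two different circles of `sD`. (For both labels, the ends `0` and `2`
lie on the two different arcs of the smoothing of `x`.) -/
def IsBichord (D : LinkDiagram X) (s : KauffmanState X) (x : X) : Prop :=
  D.circleAt s (x, 0) ≠ D.circleAt s (x, 2)

/-- An enhanced state: a Kauffman state `s` with a sign on each circle of `sD`. -/
abbrev EnhancedState (D : LinkDiagram X) : Type _ :=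
  Σ s : KauffmanState X, (D.Circle s → ℤˣ)

noncomputable instance [Finite X] (D : LinkDiagram X) (s : KauffmanState X) :
    Fintype (D.Circle s) := Fintype.ofFinite _

noncomputable instance [Finite X] (D : LinkDiagram X) : Fintype D.EnhancedState :=
  Fintype.ofFinite _

/-! ## The Khovanov complex -/

section Complex

variable [Fintype X] [LinearOrder X]

/-- The homological degree `i(s)`: the number of `B`-labels. -/
def iDeg (D : LinkDiagram X) (s : D.EnhancedState) : ℤ := numRed s.1

/-- `θ(s)`: the number of positive circles minus the number of negative circles. -/
noncomputable def theta (D : LinkDiagram X) (s : D.EnhancedState) : ℤ :=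
  ∑ c : D.Circle s.1, (s.2 c : ℤ)

/-- The quantum degree `j(s) = i(s) + θ(s)`. -/
noncomputable def jDeg (D : LinkDiagram X) (s : D.EnhancedState) : ℤ := D.iDeg s + D.theta s

/-- `t` is adjacent to `s` with change crossing `x`: the labels agree except that `x` changes from
`A` to `B`, the quantum degrees agree, and the circles that do not touch `x` (these are the common
circles of `s` and `t`) have the same signs. -/
structure AdjacentAt (D : LinkDiagram X) (s t : D.EnhancedState) (x : X) : Prop where
  label : s.1 x = Label.A
  labels : t.1 = Function.update s.1 x Label.B
  jDeg_eq : D.jDeg t = D.jDeg s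
  sign_eq : ∀ d, (∀ p, D.circleAt s.1 d ≠ D.circleAt s.1 (x, p)) →
    t.2 (D.circleAt t.1 d) = s.2 (D.circleAt s.1 d)
  sign_free : ∀ c, t.2 (Sum.inr c) = s.2 (Sum.inr c)

open Classical in
/-- The incidence number of `s` over `t`: it is `(-1) ^ m` if `t` is adjacent to `s`, where `m` is
the number of `B`-labels of `s` at crossings previous to the change crossing, and zero otherwise.
(At most one summand is not zero, since the change crossing is unique.) -/
noncomputable def incidence (D : LinkDiagram X) (s t : D.EnhancedState) : ℤ :=
  ∑ x, if D.AdjacentAt s t x then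
    (-1) ^ (Finset.univ.filter fun y => y < x ∧ s.1 y = Label.B).card else 0

/-- Integral chains. -/
abbrev Chain (D : LinkDiagram X) : Type _ := D.EnhancedState →₀ ℤ

/-- The differential `d(s) = ∑ₜ i(s,t) t`. -/
noncomputable def diff (D : LinkDiagram X) : D.Chain →ₗ[ℤ] D.Chain :=
  Finsupp.linearCombination ℤ fun s => ∑ t, Finsupp.single t (D.incidence s t)

/-- `C^{i,j}(D)`, spanned by the enhanced states of degrees `i` and `j`. -/
noncomputable def chains (D : LinkDiagram X) (i j : ℤ) : Submodule ℤ D.Chain :=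
  Finsupp.supported ℤ ℤ {s | D.iDeg s = i ∧ D.jDeg s = j}

/-- The kernel of `d` on `C^{i,j}(D)`. -/
noncomputable def cycles (D : LinkDiagram X) (i j : ℤ) : Submodule ℤ D.Chain :=
  D.chains i j ⊓ LinearMap.ker D.diff

/-- The image of `C^{i-1,j}(D)` under `d`. -/
noncomputable def boundaries (D : LinkDiagram X) (i j : ℤ) : Submodule ℤ D.Chain :=
  (D.chains (i - 1) j).map D.diff

/-- The homology `ker dᵢ / im dᵢ₋₁` of the diagram in degrees `i`, `j`. -/
abbrev Kh (D : LinkDiagram X) (i j : ℤ) : Type _ :=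
  D.cycles i j ⧸ (D.boundaries i j).submoduleOf (D.cycles i j)

/-- The homology class of a cycle. -/
noncomputable def homologyClass (D : LinkDiagram X) {i j : ℤ} (z : D.cycles i j) : D.Kh i j :=
  Submodule.Quotient.mk z

end Complex

/-! ## Orientations, and the Khovanov homology of the oriented link -/

/-- An orientation of the diagram: `out d` tells whether the strand leaves its crossing at the
end `d`. -/
structure Orientation (D : LinkDiagram X) where
  out : Dart X → Bool
  out_edge : ∀ d, out (D.edge d) = !out d
  out_opposite : ∀ d, out (rot (rot d)) = !out d

/-- The number of positive crossings: those whose `A`-smoothing respects the orientation. -/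
def Orientation.numPos [Fintype X] {D : LinkDiagram X} (o : D.Orientation) : ℕ :=
  (Finset.univ.filter fun x => o.out (x, 0) ≠ o.out (x, 1)).card

/-- The number of negative crossings. -/
def Orientation.numNeg [Fintype X] {D : LinkDiagram X} (o : D.Orientation) : ℕ :=
  (Finset.univ.filter fun x => o.out (x, 0) = o.out (x, 1)).card

/-- The Khovanov homology `Kh^{h,q}(L)` of the oriented link `L` with oriented diagram `D`, which
is the homology of `D` in degrees `i = h + n`, `j = q - p + 2 n`. -/
abbrev KhLink [Fintype X] [LinearOrder X] (D : LinkDiagram X) (o : D.Orientation) (h q : ℤ) :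
    Type _ :=
  D.Kh (h + o.numNeg) (q - o.numPos + 2 * o.numNeg)

/-! ## Ladders -/

/-- We look at a blue scar with its two ends at the left and at the right, so that its crossing
has a lower left, lower right, upper right and upper left end: `d, rot d, rot (rot d)` and
`rot (rot (rot d))`. `IsLowerLeft s d` says that the scar of the crossing of `d` is blue and that
`d` is its lower left end for one of the two ways to look at it, that is, the smoothing joins the
lower left end to the upper left one. -/
def IsLowerLeft (s : KauffmanState X) (d : Dart X) : Prop :=
  s d.1 = Label.A ∧ smooth s d = rot (rot (rot d))

/-- The scars with lower left ends `d` and `d'` are consecutive parallel scars, the second one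
below the first: the lower ends of the first one are joined by edges to the upper ends of the
second one, and the scars and these edges bound a quadrilateral. -/
def Parallel (D : LinkDiagram X) (d d' : Dart X) : Prop :=
  D.edge d = rot (rot (rot d')) ∧ D.edge (rot d) = rot (rot d')

/-- A blue ladder of `sD`, with its steps listed from top to bottom, each one given by its lower
left end. -/
structure Ladder (D : LinkDiagram X) (s : KauffmanState X) where
  height : ℕ
  height_pos : 0 < height
  step : Fin height → Dart X
  blue : ∀ a, IsLowerLeft s (step a)
  injective : Function.Injective fun a => (step a).1
  parallel : ∀ a b : Fin height, (b : ℕ) = a + 1 → D.Parallel (step a) (step b)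
  /-- No further blue scar can be added below the last step. -/
  maximal_below : ∀ d, IsLowerLeft s d → D.Parallel (step ⟨height - 1, by omega⟩) d →
    ∃ a, (step a).1 = d.1
  /-- No further blue scar can be added above the first step. -/
  maximal_above : ∀ d, IsLowerLeft s d → D.Parallel d (step ⟨0, height_pos⟩) →
    ∃ a, (step a).1 = d.1

namespace Ladder

variable {D : LinkDiagram X} {s : KauffmanState X}

/-- The crossing of the `a`-th step. -/
def crossing (H : Ladder D s) (a : Fin H.height) : X := (H.step a).1

/-- The upper left end of the first step. -/
def top (H : Ladder D s) : Dart X := rot (rot (rot (H.step ⟨0, H.height_pos⟩)))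

/-- The lower left end of the last step. -/
def bottom (H : Ladder D s) : Dart X :=
  H.step ⟨H.height - 1, Nat.sub_lt H.height_pos Nat.one_pos⟩

end Ladder

section Ladders

variable {D : LinkDiagram X} {s₀ : KauffmanState X} {k : ℕ}

/-- The blue scars of `s₀D` are grouped into the ladders `H i`: each blue scar is a step of exactly
one of them. -/
def IsGrouping (H : Fin k → Ladder D s₀) : Prop :=
  (∀ x, s₀ x = Label.A → ∃ i a, (H i).crossing a = x) ∧
    ∀ i i' a a', (H i).crossing a = (H i').crossing a' → i = i'

/-- The crossings are ordered according to the ladders: first the crossings of the first ladder in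
the order of its steps, then those of the second one, and so on, and finally the other ones. -/
def IsOrdered [LinearOrder X] (H : Fin k → Ladder D s₀) : Prop :=
  (∀ i a b, a < b → (H i).crossing a < (H i).crossing b) ∧
  (∀ i i' a a', i < i' → (H i).crossing a < (H i').crossing a') ∧
  ∀ i a x, (∀ i' a', (H i').crossing a' ≠ x) → (H i).crossing a < x

open Classical in
/-- The Kauffman state `s(M₁, …, M_k; )`, obtained from `s₀` by changing into red the steps in
`M i` of each ladder `H i`. -/
noncomputable def redden (H : Fin k → Ladder D s₀) (M : ∀ i, Finset (Fin (H i).height)) :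
    KauffmanState X :=
  fun x => if ∃ i, ∃ a ∈ M i, (H i).crossing a = x then Label.B else s₀ x

/-- The periphery of `H i`: we cut all the ladders, joining the two upper ends and the two lower
ends of each one, and take the circles that touch the two extremes of `H i`. The cutting is
realized by changing all steps of all ladders into red. This creates, besides the circles of
the cut diagram, only the small circles between consecutive steps of a ladder, which do not
touch its extremes. -/
def periphery (H : Fin k → Ladder D s₀) (i : Fin k) :
    Set (D.Circle (redden H fun _ => Finset.univ)) :=
  {D.circleAt _ (H i).top, D.circleAt _ (H i).bottom}

/-- The periphery number of `H i`. -/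
noncomputable def peripheryNumber (H : Fin k → Ladder D s₀) (i : Fin k) : ℕ :=
  (periphery H i).ncard

open Classical in
/-- The enhanced state on `s(M₁, …, M_k; )` with all signs positive except that of the circle
`C_i^0`. The latter is the circle through the upper extreme of `H i`: it runs down along the blue
steps above the first red step of `H i`, and touches this red step from above. -/
noncomputable def reddenMinus (H : Fin k → Ladder D s₀) (i : Fin k)
    (M : ∀ i, Finset (Fin (H i).height)) : D.EnhancedState :=
  ⟨redden H M, fun c => if c = D.circleAt _ (H i).top then -1 else 1⟩

/-- The chain `s(ν₁, …, ν_k; C_i^{0-})`: the sum over all choices of `ν l` steps of each ladder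
`H l`. -/
noncomputable def chainMinus (H : Fin k → Ladder D s₀) (i : Fin k) (ν : Fin k → ℕ) :
    D.EnhancedState →₀ ℤ :=
  ∑ M ∈ Fintype.piFinset fun l => Finset.powersetCard (ν l) Finset.univ,
    Finsupp.single (reddenMinus H i M) 1

/-- The chain `V(μ₁, …, μ_k)`, the sum over all `i` with `μ i` even and `μ i < h i` of
`(-1) ^ (μ₁ + ⋯ + μ_{i-1}) s(…, μ_{i-1}, 1 + μ_i, μ_{i+1}, …; C_i^{0-})`. -/
noncomputable def chainV (H : Fin k → Ladder D s₀) (μ : Fin k → ℕ) : D.EnhancedState →₀ ℤ :=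
  ∑ i with Even (μ i) ∧ μ i < (H i).height,
    (-1 : ℤ) ^ (∑ l with l < i, μ l) • chainMinus H i (Function.update μ i (1 + μ i))

end Ladders

end LinkDiagram

end KhovanovLadders

namespace KhovanovLadders

/-! Let P be the sum, over all choices of `μ l` red steps in each ladder, of the states with all
circles positive (`chainPlus`). The torsion comes from dP = 2V, where V itself is not a boundary.

Computing dP: if a ladder has at least two red steps, each of them is a bichord, so adding a red
step to a ladder that already has one splits a circle, and a positive circle gives one negative and
one positive circle (`adjacentAt_one_iff`). For a fixed target state, the contributions of the red
steps of one ladder carry alternating signs, and consecutive red steps share the circle between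
them. The sum therefore telescopes to the circles at the top and the bottom of the ladder
(`sum_step_telescope`). Periphery number one makes these two circles equal, so what remains is the
factor 1 - (-1)^(μ+1), which is 2 for even μ and 0 for odd μ. This is `diff_chainPlus`.

That dV = 0 follows from the same telescoping with one circle already negative: the contributions of
raising ladder i and then ladder l, and of raising l and then i, cancel (`diff_chainV`).

For V not to be a boundary, a parity functional is used. If all red scars of a Kauffman state t are
bichords, a state with a nonzero incidence number at an enhancement of t with exactly one negative
circle must be all positive, and each change crossing then reaches exactly two such enhancements,
with equal signs. Hence a boundary has an even sum of coefficients over these enhancements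
(`even_sum_diff`). On a suitable t this sum is ±1 for V. The red scars of `s₀` are bichords of t
because a state with one red step per ladder has the coarsest circles (`circleAt_singleton_eq`), so
the hypothesis on s₁ passes to t. -/

theorem Label.join_join (l : Label) (p : Fin 4) : l.join (l.join p) = p := by
  cases l <;> fin_cases p <;> rfl

theorem Label.join_ne (l : Label) (p : Fin 4) : l.join p ≠ p := by
  cases l <;> fin_cases p <;> decide

theorem smooth_smooth {X : Type*} (s : KauffmanState X) (d : Dart X) :
    smooth s (smooth s d) = d := by
  simp [smooth, Label.join_join]

theorem smooth_ne {X : Type*} (s : KauffmanState X) (d : Dart X) : smooth s d ≠ d :=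
  fun h => Label.join_ne _ _ (congrArg Prod.snd h)

namespace LinkDiagram

variable {X : Type*} (D : LinkDiagram X)

/-! ## Circles of a Kauffman state -/

section Circles

variable {D} {s : KauffmanState X}

@[simp]
theorem circleAt_edge (d : Dart X) : D.circleAt s (D.edge d) = D.circleAt s d :=
  congrArg Sum.inl (Quotient.sound (EqvGen.symm _ _ (EqvGen.rel _ _ (Or.inl rfl))))

theorem circleAt_smooth (d : Dart X) : D.circleAt s (smooth s d) = D.circleAt s d :=
  congrArg Sum.inl (Quotient.sound (EqvGen.symm _ _ (EqvGen.rel _ _ (Or.inr rfl))))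

/-- A function of the ends that is constant along edges and smoothings is constant on circles. -/
theorem eq_of_circleAt_eq {α : Sort*} (f : Dart X → α) (he : ∀ d, f (D.edge d) = f d)
    (hs : ∀ d, f (smooth s d) = f d) {d d' : Dart X} (h : D.circleAt s d = D.circleAt s d') :
    f d = f d' := by
  have h' : EqvGen (fun d d' => d' = D.edge d ∨ d' = smooth s d) d d' :=
    Quotient.exact (Sum.inl_injective h)
  clear h
  induction h' with
  | rel a b h => rcases h with rfl | rfl <;> simp [he, hs]
  | refl => rfl
  | symm _ _ _ ih => exact ih.symm
  | trans _ _ _ _ _ ih₁ ih₂ => exact ih₁.trans ih₂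

/-- Edges and smoothings are involutions, so preservation of `P` in one direction already makes it
invariant. -/
theorem of_circleAt_eq (P : Dart X → Prop) (he : ∀ d, P d → P (D.edge d))
    (hs : ∀ d, P d → P (smooth s d)) {d d' : Dart X} (h : D.circleAt s d = D.circleAt s d')
    (hd : P d) : P d' := by
  refine (eq_of_circleAt_eq (D := D) (s := s) P (fun d => propext ⟨fun h => ?_, he d⟩)
    (fun d => propext ⟨fun h => ?_, hs d⟩) h).mp hd
  · simpa [D.edge_edge] using he _ h
  · simpa [smooth_smooth] using hs _ h

theorem circle_cases (c : D.Circle s) : (∃ d, c = D.circleAt s d) ∨ ∃ j, c = Sum.inr j := by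
  rcases c with q | j
  · induction q using Quotient.inductionOn with
    | h d => exact Or.inl ⟨d, rfl⟩
  · exact Or.inr ⟨j, rfl⟩

theorem circleAt_B {x : X} (hx : s x = Label.B) :
    D.circleAt s (x, 1) = D.circleAt s (x, 2) ∧ D.circleAt s (x, 3) = D.circleAt s (x, 0) := by
  refine ⟨?_, ?_⟩
  · simpa [smooth, hx, Label.join] using circleAt_smooth (D := D) (s := s) (x, 2)
  · simpa [smooth, hx, Label.join] using circleAt_smooth (D := D) (s := s) (x, 0)

theorem circleAt_A {x : X} (hx : s x = Label.A) :
    D.circleAt s (x, 1) = D.circleAt s (x, 0) ∧ D.circleAt s (x, 3) = D.circleAt s (x, 2) := by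
  refine ⟨?_, ?_⟩
  · simpa [smooth, hx, Label.join] using circleAt_smooth (D := D) (s := s) (x, 0)
  · simpa [smooth, hx, Label.join] using circleAt_smooth (D := D) (s := s) (x, 2)

end Circles

/-! ## Changing a bichord -/

section Merge

variable {D} [Finite X] [DecidableEq X] {s t : KauffmanState X} {x : X}

/-- Walking along a circle from an end of a red bichord, one comes back to this bichord without
having met it in between. -/
theorem walk_of_isBichord (hb : D.IsBichord t x) (ht : t x = Label.B) {q : Fin 4}
    (P : Dart X → Prop) (hq : P (x, q)) (he : ∀ d, P d → P (D.edge d))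
    (hs : ∀ d, d.1 ≠ x → P d → P (smooth t d)) : P (x, Label.B.join q) := by
  classical
  have := Fintype.ofFinite X
  by_contra hcon
  -- A parity count: edges pair off the ends in `K`, and smoothings pair off those away from `x`. If
  -- the walk did not come back, `(x, q)` alone would be left unpaired.
  set K : Finset (Dart X) :=
    Finset.univ.filter fun d => P d ∧ D.circleAt t d = D.circleAt t (x, q) with hK
  have h1 : ∑ d ∈ K, (1 : ZMod 2) = 0 := by
    refine Finset.sum_involution (fun d _ => D.edge d) (fun _ _ => by decide)
      (fun d _ _ => D.edge_ne d) (fun d hd => ?_) fun d _ => D.edge_edge d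
    simp only [hK, Finset.mem_filter, Finset.mem_univ, true_and] at hd ⊢
    exact ⟨he _ hd.1, by simpa using hd.2⟩
  have h2 : ∑ d ∈ K.filter fun d => d.1 ≠ x, (1 : ZMod 2) = 0 := by
    refine Finset.sum_involution (fun d _ => smooth t d) (fun _ _ => by decide)
      (fun d _ _ => smooth_ne t d) (fun d hd => ?_) fun d _ => smooth_smooth t d
    simp only [hK, Finset.mem_filter, Finset.mem_univ, true_and] at hd ⊢
    exact ⟨⟨hs _ hd.2 hd.1.1, by rw [circleAt_smooth]; exact hd.1.2⟩, hd.2⟩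
  have h3 : K.filter (fun d => ¬ d.1 ≠ x) = {(x, q)} := by
    have hB := circleAt_B (D := D) ht
    have hne : D.circleAt t (x, 0) ≠ D.circleAt t (x, 2) := hb
    ext ⟨y, p⟩
    simp only [hK, Finset.mem_filter, Finset.mem_univ, true_and, not_not, Finset.mem_singleton,
      Prod.mk.injEq]
    constructor
    · rintro ⟨⟨hP, hc⟩, rfl⟩
      refine ⟨rfl, ?_⟩
      fin_cases p <;> fin_cases q <;> simp_all [Label.join]
    · rintro ⟨rfl, rfl⟩
      exact ⟨⟨hq, rfl⟩, rfl⟩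
  rw [← Finset.sum_filter_add_sum_filter_not K (fun d => d.1 ≠ x), h2, h3] at h1
  simp at h1

variable (hsx : s x = Label.A) (hts : t = Function.update s x Label.B) (hb : D.IsBichord t x)
include hsx hts hb

/-- The walk along the circle of `t` from end 1 back to end 2 avoids the crossing `x` in between,
hence is also a walk in `s`. The `A`-smoothing supplies the links 0–1 and 2–3. -/
theorem circleAt_ends_eq (p q : Fin 4) : D.circleAt s (x, p) = D.circleAt s (x, q) := by
  have ht : t x = Label.B := by simp [hts]
  have hA := circleAt_A (D := D) hsx
  have key : D.circleAt s (x, 1) = D.circleAt s (x, 2) := by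
    refine (walk_of_isBichord hb ht (q := 1)
      (fun d => D.circleAt s (x, 1) = D.circleAt s d) rfl (fun d h => by simpa using h) ?_)
    intro d hd h
    have : smooth t d = smooth s d := by simp [smooth, hts, hd]
    rw [this, circleAt_smooth, h]
  fin_cases p <;> fin_cases q <;> simp_all

theorem circleAt_eq_of_eq {d d' : Dart X} (h : D.circleAt t d = D.circleAt t d') :
    D.circleAt s d = D.circleAt s d' := by
  refine eq_of_circleAt_eq (fun d => D.circleAt s d) (fun d => circleAt_edge d) (fun d => ?_) h
  by_cases hd : d.1 = x
  · obtain ⟨y, p⟩ := d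
    obtain rfl : y = x := hd
    exact circleAt_ends_eq hsx hts hb _ _
  · have : smooth t d = smooth s d := by simp [smooth, hts, hd]
    simp only [this, circleAt_smooth]

omit [Finite X] hsx hb in
theorem circleAt_end (p : Fin 4) :
    D.circleAt t (x, p) = D.circleAt t (x, 0) ∨ D.circleAt t (x, p) = D.circleAt t (x, 2) := by
  have hB := circleAt_B (D := D) (s := t) (x := x) (by simp [hts])
  fin_cases p <;> simp [hB]

/-- The circles of `s` are those of `t`, with the two that meet at the bichord merged into one. -/
theorem circleAt_eq_iff {d d' : Dart X} : D.circleAt s d = D.circleAt s d' ↔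
    D.circleAt t d = D.circleAt t d' ∨
    (D.circleAt t d = D.circleAt t (x, 0) ∨ D.circleAt t d = D.circleAt t (x, 2)) ∧
    (D.circleAt t d' = D.circleAt t (x, 0) ∨ D.circleAt t d' = D.circleAt t (x, 2)) := by
  constructor
  · intro h
    refine of_circleAt_eq (fun d' => D.circleAt t d = D.circleAt t d' ∨
      (D.circleAt t d = D.circleAt t (x, 0) ∨ D.circleAt t d = D.circleAt t (x, 2)) ∧
      (D.circleAt t d' = D.circleAt t (x, 0) ∨ D.circleAt t d' = D.circleAt t (x, 2)))
      (fun e he => by simpa using he) (fun e he => ?_) h (Or.inl rfl)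
    by_cases hx : e.1 = x
    · obtain ⟨y, p⟩ := e
      obtain rfl : y = x := hx
      have h1 := circleAt_end (D := D) hts p
      refine Or.inr ⟨?_, circleAt_end (D := D) hts _⟩
      rcases he with he | he
      · rwa [he]
      · exact he.1
    · have : smooth s e = smooth t e := by simp [smooth, hts, hx]
      simpa only [this, circleAt_smooth] using he
  · rintro (h | ⟨h, h'⟩)
    · exact circleAt_eq_of_eq hsx hts hb h
    · have key : ∀ e, D.circleAt t e = D.circleAt t (x, 0) ∨ D.circleAt t e = D.circleAt t (x, 2) →
          D.circleAt s e = D.circleAt s (x, 0) := by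
        rintro e (he | he)
        · exact circleAt_eq_of_eq hsx hts hb he
        · exact (circleAt_eq_of_eq hsx hts hb he).trans (circleAt_ends_eq hsx hts hb _ _)
      rw [key d h, key d' h']

/-- The circle of `s` that contains a given circle of `t`, apart from the change at `x`. -/
def mergeMap : D.Circle t → D.Circle s :=
  Sum.map (Quotient.map id fun d d' h =>
    Quotient.exact (Sum.inl_injective (circleAt_eq_of_eq (D := D) (d := d) (d' := d') hsx hts hb
      (congrArg Sum.inl (Quotient.sound h))))) id

theorem mergeMap_circleAt (d : Dart X) :
    mergeMap hsx hts hb (D.circleAt t d) = D.circleAt s d := rfl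

theorem mergeMap_surjective : Function.Surjective (mergeMap hsx hts hb) := by
  intro c
  rcases circle_cases c with ⟨d, rfl⟩ | ⟨j, rfl⟩
  · exact ⟨D.circleAt t d, rfl⟩
  · exact ⟨Sum.inr j, rfl⟩

theorem mergeMap_eq_iff {c c' : D.Circle t} : mergeMap hsx hts hb c = mergeMap hsx hts hb c' ↔
    c = c' ∨ (c = D.circleAt t (x, 0) ∨ c = D.circleAt t (x, 2)) ∧
      (c' = D.circleAt t (x, 0) ∨ c' = D.circleAt t (x, 2)) := by
  rcases circle_cases c with ⟨d, rfl⟩ | ⟨j, rfl⟩ <;>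
    rcases circle_cases c' with ⟨d', rfl⟩ | ⟨j', rfl⟩
  · exact circleAt_eq_iff hsx hts hb
  · simp [mergeMap, circleAt]
  · simp [mergeMap, circleAt]
  · simp [mergeMap, circleAt]

/-- `mergeMap` is injective except that two circles go to the one through `x`; without the circle of
`(x, 0)` it becomes a bijection. -/
theorem sum_mergeMap (f : D.Circle s → ℤ) :
    ∑ c, f (mergeMap hsx hts hb c) = ∑ c, f c + f (D.circleAt s (x, 0)) := by
  classical
  rw [← Finset.sum_erase_add _ _ (Finset.mem_univ (D.circleAt t (x, 0))), mergeMap_circleAt]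
  congr 1
  refine Finset.sum_bij (fun c _ => mergeMap hsx hts hb c) (fun _ _ => Finset.mem_univ _) ?_ ?_
    fun _ _ => rfl
  · intro c hc c' hc' h
    rcases (mergeMap_eq_iff hsx hts hb).mp h with h | ⟨h, h'⟩
    · exact h
    · rw [h.resolve_left (Finset.ne_of_mem_erase hc), h'.resolve_left (Finset.ne_of_mem_erase hc')]
  · intro c _
    obtain ⟨e, rfl⟩ := mergeMap_surjective hsx hts hb c
    by_cases he : e = D.circleAt t (x, 0)
    · refine ⟨D.circleAt t (x, 2), by simpa using hb.symm, ?_⟩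
      rw [mergeMap_eq_iff]
      exact Or.inr ⟨Or.inr rfl, Or.inl he⟩
    · exact ⟨e, by simpa using he, rfl⟩

theorem numCircles_eq_add_one : D.numCircles t = D.numCircles s + 1 := by
  have := sum_mergeMap hsx hts hb fun _ => 1
  simp only [Finset.sum_const, Finset.card_univ, nsmul_eq_mul, mul_one, numCircles,
    Nat.card_eq_fintype_card] at this ⊢
  exact_mod_cast this

end Merge

/-! ### Enhancements with one negative circle. -/

section Signs

variable {D} {s : KauffmanState X}

open Classical in
/-- All circles are positive except one. -/
noncomputable def minusAt (c : D.Circle s) : D.Circle s → ℤˣ :=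
  fun c' => if c' = c then -1 else 1

theorem minusAt_self (c : D.Circle s) : minusAt c c = -1 := if_pos rfl

theorem minusAt_of_ne {c c' : D.Circle s} (h : c' ≠ c) : minusAt c c' = 1 := if_neg h

theorem minusAt_injective : Function.Injective (minusAt (D := D) (s := s)) := by
  intro c c' h
  by_contra hne
  have := congrFun h c
  rw [minusAt_self, minusAt_of_ne hne] at this
  exact absurd this (by decide)

theorem units_add_eq_zero_iff (a b : ℤˣ) :
    (a + b : ℤ) = 0 ↔ a = -1 ∧ b = 1 ∨ a = 1 ∧ b = -1 := by
  rcases Int.units_eq_one_or a with rfl | rfl <;> rcases Int.units_eq_one_or b with rfl | rfl <;>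
    decide

theorem units_add_eq_neg_two_iff (a b : ℤˣ) : (a + b : ℤ) = -2 ↔ a = -1 ∧ b = -1 := by
  rcases Int.units_eq_one_or a with rfl | rfl <;> rcases Int.units_eq_one_or b with rfl | rfl <;>
    decide

end Signs

/-! ### Adjacency at a bichord: the coproduct rules. -/

section Adjacent

variable {D} [Fintype X] [LinearOrder X] {s t : KauffmanState X} {x : X}

theorem numRed_update (hsx : s x = Label.A) :
    numRed (Function.update s x Label.B) = numRed s + 1 := by
  have : (Finset.univ.filter fun y => Function.update s x Label.B y = Label.B) =
      insert x (Finset.univ.filter fun y => s y = Label.B) := by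
    ext y
    by_cases h : y = x <;> simp [h]
  rw [numRed, this, Finset.card_insert_of_notMem (by simp [hsx]), numRed]

variable (hsx : s x = Label.A) (hts : t = Function.update s x Label.B) (hb : D.IsBichord t x)

/-- When `x` is a bichord of `t`, the adjacent enhanced states obey the rules of the coproduct. -/
theorem adjacentAt_iff (τ : D.Circle s → ℤˣ) (σ : D.Circle t → ℤˣ) :
    D.AdjacentAt ⟨s, τ⟩ ⟨t, σ⟩ x ↔
      (∀ c, c ≠ D.circleAt t (x, 0) → c ≠ D.circleAt t (x, 2) → σ c = τ (mergeMap hsx hts hb c)) ∧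
      (σ (D.circleAt t (x, 0)) + σ (D.circleAt t (x, 2)) : ℤ) = τ (D.circleAt s (x, 0)) - 1 := by
  classical
  -- The number of red scars grows by one, so equality of quantum degrees means that `theta` drops
  -- by one. Away from `x` nothing changes, which leaves a condition on the three circles at `x`.
  have hj (h : ∀ c, c ≠ D.circleAt t (x, 0) → c ≠ D.circleAt t (x, 2) →
      σ c = τ (mergeMap hsx hts hb c)) :
      D.jDeg ⟨t, σ⟩ = D.jDeg ⟨s, τ⟩ ↔
      (σ (D.circleAt t (x, 0)) + σ (D.circleAt t (x, 2)) : ℤ) = τ (D.circleAt s (x, 0)) - 1 := by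
    have h1 : ∑ c, ((σ c : ℤ) - τ (mergeMap hsx hts hb c)) =
        (σ (D.circleAt t (x, 0)) - τ (D.circleAt s (x, 0))) +
        (σ (D.circleAt t (x, 2)) - τ (D.circleAt s (x, 0))) := by
      rw [← Finset.sum_subset (Finset.subset_univ {D.circleAt t (x, 0), D.circleAt t (x, 2)}),
        Finset.sum_pair hb, mergeMap_circleAt, mergeMap_circleAt,
        circleAt_ends_eq hsx hts hb 2 0]
      intro c _ hc
      simp only [Finset.mem_insert, Finset.mem_singleton, not_or] at hc
      rw [h c hc.1 hc.2, sub_self]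
    have h2 := sum_mergeMap hsx hts hb fun c => (τ c : ℤ)
    rw [Finset.sum_sub_distrib, h2] at h1
    have h3 : (numRed t : ℤ) = numRed s + 1 := by rw [hts, numRed_update hsx]; push_cast; ring
    simp only [jDeg, iDeg, theta, h3]
    constructor <;> intro h4 <;> linarith
  have hs : (∀ c, c ≠ D.circleAt t (x, 0) → c ≠ D.circleAt t (x, 2) →
      σ c = τ (mergeMap hsx hts hb c)) ↔
      (∀ d, (∀ p, D.circleAt s d ≠ D.circleAt s (x, p)) →
        σ (D.circleAt t d) = τ (D.circleAt s d)) ∧ ∀ c, σ (Sum.inr c) = τ (Sum.inr c) := by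
    have hd (d : Dart X) : (∀ p, D.circleAt s d ≠ D.circleAt s (x, p)) ↔
        D.circleAt t d ≠ D.circleAt t (x, 0) ∧ D.circleAt t d ≠ D.circleAt t (x, 2) := by
      have : (∀ p, D.circleAt s d ≠ D.circleAt s (x, p)) ↔
          D.circleAt s d ≠ D.circleAt s (x, 0) :=
        ⟨fun h => h 0, fun h p => by rwa [circleAt_ends_eq hsx hts hb p 0]⟩
      rw [this, Ne, circleAt_eq_iff hsx hts hb]
      tauto
    constructor
    · refine fun h => ⟨fun d h' => ?_, fun c => h _ (by simp [circleAt]) (by simp [circleAt])⟩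
      exact h _ ((hd d).mp h').1 ((hd d).mp h').2
    · rintro ⟨h, h'⟩ c hc hc'
      rcases circle_cases c with ⟨d, rfl⟩ | ⟨j, rfl⟩
      · exact h d ((hd d).mpr ⟨hc, hc'⟩)
      · exact h' j
  constructor
  · intro h
    have h' := hs.mpr ⟨h.sign_eq, h.sign_free⟩
    exact ⟨h', (hj h').mp h.jDeg_eq⟩
  · rintro ⟨h, h'⟩
    exact ⟨hsx, hts, (hj h).mpr h', (hs.mp h).1, (hs.mp h).2⟩

include hsx hts hb in
theorem adjacentAt_one_iff (σ : D.Circle t → ℤˣ) :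
    D.AdjacentAt ⟨s, 1⟩ ⟨t, σ⟩ x ↔
      σ = minusAt (D.circleAt t (x, 0)) ∨ σ = minusAt (D.circleAt t (x, 2)) := by
  rw [adjacentAt_iff hsx hts hb]
  simp only [Pi.one_apply, Units.val_one, sub_self, units_add_eq_zero_iff]
  have hne : D.circleAt t (x, 0) ≠ D.circleAt t (x, 2) := hb
  constructor
  · rintro ⟨h, h' | h'⟩
    · left
      funext c
      by_cases h0 : c = D.circleAt t (x, 0)
      · rw [h0, minusAt_self, h'.1]
      · rw [minusAt_of_ne h0]
        by_cases h2 : c = D.circleAt t (x, 2)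
        · rw [h2, h'.2]
        · exact h c h0 h2
    · right
      funext c
      by_cases h2 : c = D.circleAt t (x, 2)
      · rw [h2, minusAt_self, h'.2]
      · rw [minusAt_of_ne h2]
        by_cases h0 : c = D.circleAt t (x, 0)
        · rw [h0, h'.1]
        · exact h c h0 h2
  · rintro (rfl | rfl)
    · exact ⟨fun c h _ => minusAt_of_ne h, Or.inl ⟨minusAt_self _, minusAt_of_ne hne.symm⟩⟩
    · exact ⟨fun c _ h => minusAt_of_ne h, Or.inr ⟨minusAt_of_ne hne, minusAt_self _⟩⟩

-- A split positive circle acquires one minus sign, a split negative one becomes two negative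
-- circles. Both cases read alike: a new minus is put on a circle at `x` other than the circle of
-- `d`. If `d` lies on a circle at `x`, only one alternative survives.
include hsx hts hb in
theorem adjacentAt_minusAt_iff (σ : D.Circle t → ℤˣ) (d : Dart X) :
    D.AdjacentAt ⟨s, minusAt (D.circleAt s d)⟩ ⟨t, σ⟩ x ↔
      (D.circleAt t (x, 0) ≠ D.circleAt t d ∧
        σ = minusAt (D.circleAt t (x, 0)) * minusAt (D.circleAt t d)) ∨
      (D.circleAt t (x, 2) ≠ D.circleAt t d ∧
        σ = minusAt (D.circleAt t (x, 2)) * minusAt (D.circleAt t d)) := by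
  rw [adjacentAt_iff hsx hts hb]
  have hne : D.circleAt t (x, 0) ≠ D.circleAt t (x, 2) := hb
  have hm (c) (h0 : c ≠ D.circleAt t (x, 0)) (h2 : c ≠ D.circleAt t (x, 2)) :
      minusAt (D.circleAt s d) (mergeMap hsx hts hb c) = minusAt (D.circleAt t d) c := by
    have : mergeMap hsx hts hb c = D.circleAt s d ↔ c = D.circleAt t d := by
      rw [← mergeMap_circleAt hsx hts hb, mergeMap_eq_iff]
      tauto
    by_cases h : c = D.circleAt t d
    · rw [this.mpr h, h, minusAt_self, minusAt_self]
    · rw [minusAt_of_ne h, minusAt_of_ne (mt this.mp h)]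
  have hx : D.circleAt s (x, 0) = D.circleAt s d ↔
      D.circleAt t d = D.circleAt t (x, 0) ∨ D.circleAt t d = D.circleAt t (x, 2) := by
    rw [circleAt_eq_iff hsx hts hb, eq_comm]
    tauto
  have hall : (∀ c, c ≠ D.circleAt t (x, 0) → c ≠ D.circleAt t (x, 2) →
      σ c = minusAt (D.circleAt s d) (mergeMap hsx hts hb c)) ↔
      ∀ c, c ≠ D.circleAt t (x, 0) → c ≠ D.circleAt t (x, 2) →
        σ c = minusAt (D.circleAt t d) c :=
    forall_congr' fun c => forall_congr' fun h0 => forall_congr' fun h2 => by rw [hm c h0 h2]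
  have hext (f : D.Circle t → ℤˣ) : σ = f ↔
      (∀ c, c ≠ D.circleAt t (x, 0) → c ≠ D.circleAt t (x, 2) → σ c = f c) ∧
      σ (D.circleAt t (x, 0)) = f (D.circleAt t (x, 0)) ∧
      σ (D.circleAt t (x, 2)) = f (D.circleAt t (x, 2)) := by
    refine ⟨fun h => by simp [h], fun ⟨h, h0, h2⟩ => funext fun c => ?_⟩
    by_cases hc0 : c = D.circleAt t (x, 0)
    · rw [hc0, h0]
    by_cases hc2 : c = D.circleAt t (x, 2)
    · rw [hc2, h2]
    exact h c hc0 hc2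
  have hmul0 : (∀ c, c ≠ D.circleAt t (x, 0) → c ≠ D.circleAt t (x, 2) →
      σ c = (minusAt (D.circleAt t (x, 0)) * minusAt (D.circleAt t d)) c) ↔
      ∀ c, c ≠ D.circleAt t (x, 0) → c ≠ D.circleAt t (x, 2) →
        σ c = minusAt (D.circleAt t d) c :=
    forall_congr' fun c => forall_congr' fun h0 => forall_congr' fun h2 => by
      rw [Pi.mul_apply, minusAt_of_ne h0, one_mul]
  have hmul2 : (∀ c, c ≠ D.circleAt t (x, 0) → c ≠ D.circleAt t (x, 2) →
      σ c = (minusAt (D.circleAt t (x, 2)) * minusAt (D.circleAt t d)) c) ↔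
      ∀ c, c ≠ D.circleAt t (x, 0) → c ≠ D.circleAt t (x, 2) →
        σ c = minusAt (D.circleAt t d) c :=
    forall_congr' fun c => forall_congr' fun h0 => forall_congr' fun h2 => by
      rw [Pi.mul_apply, minusAt_of_ne h2, one_mul]
  rw [hext, hext, hmul0, hmul2, hall]
  simp only [Pi.mul_apply, minusAt_self, minusAt_of_ne hne, minusAt_of_ne hne.symm]
  by_cases h0 : D.circleAt t d = D.circleAt t (x, 0)
  · rw [hx.mpr (Or.inl h0), minusAt_self, h0, minusAt_self, minusAt_of_ne hne.symm]
    simp only [Units.val_neg, Units.val_one, show (-1 - 1 : ℤ) = -2 by norm_num,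
      units_add_eq_neg_two_iff, ne_eq, not_true, false_and, false_or, hne.symm, not_false_eq_true,
      true_and, one_mul, mul_one]
  by_cases h2 : D.circleAt t d = D.circleAt t (x, 2)
  · rw [hx.mpr (Or.inr h2), minusAt_self, h2, minusAt_self, minusAt_of_ne hne]
    simp only [Units.val_neg, Units.val_one, show (-1 - 1 : ℤ) = -2 by norm_num,
      units_add_eq_neg_two_iff, ne_eq, not_true, false_and, or_false, hne, not_false_eq_true,
      true_and, one_mul, mul_one]
  · rw [minusAt_of_ne (fun h => (hx.mp h).elim h0 h2), minusAt_of_ne (Ne.symm h0),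
      minusAt_of_ne (Ne.symm h2)]
    simp only [Units.val_one, sub_self, units_add_eq_zero_iff, ne_eq, Ne.symm h0, Ne.symm h2,
      not_false_eq_true, true_and, mul_one]
    tauto

end Adjacent

variable {X : Type*} {D : LinkDiagram X}

/-! ## A criterion for not being a boundary -/

section Boundary

variable [Fintype X] [LinearOrder X]

theorem diff_apply (z : D.Chain) (t : D.EnhancedState) :
    D.diff z t = z.sum fun s a => a * D.incidence s t := by
  rw [diff, Finsupp.linearCombination_apply, Finsupp.sum, Finsupp.finsetSum_apply]
  refine Finset.sum_congr rfl fun s _ => ?_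
  rw [Finsupp.smul_apply, Finsupp.finsetSum_apply, smul_eq_mul]
  congr 1
  rw [Finset.sum_eq_single t (fun u _ hu => Finsupp.single_eq_of_ne hu.symm) (by simp),
    Finsupp.single_eq_same]

/-- For each change crossing `x`, either no enhancement with one minus is adjacent to `T`, or
exactly two are. The sign depends on `T` and `x` only, so the two contributions are equal. -/
theorem even_sum_incidence {t : KauffmanState X} (ht : ∀ x, t x = Label.B → D.IsBichord t x)
    (T : D.EnhancedState) : Even (∑ c, D.incidence T ⟨t, minusAt c⟩) := by
  classical
  simp only [incidence]
  rw [Finset.sum_comm]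
  refine Finset.even_sum _ fun x _ => ?_
  by_cases hex : ∃ c, D.AdjacentAt T ⟨t, minusAt c⟩ x
  swap
  · push Not at hex
    simp [hex]
  obtain ⟨c₀, h₀⟩ := hex
  obtain ⟨s, τ⟩ := T
  have hsx : s x = Label.A := h₀.label
  have hts : t = Function.update s x Label.B := h₀.labels
  have hb : D.IsBichord t x := ht x (by simp [hts])
  have hne : D.circleAt t (x, 0) ≠ D.circleAt t (x, 2) := hb
  rw [adjacentAt_iff hsx hts hb] at h₀
  obtain ⟨h₁, h₂⟩ := h₀
  -- Otherwise both circles at `x` would be positive, and 2 = ±1 - 1 is impossible.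
  have hc₀ : c₀ = D.circleAt t (x, 0) ∨ c₀ = D.circleAt t (x, 2) := by
    by_contra hcon
    push Not at hcon
    rw [minusAt_of_ne hcon.1.symm, minusAt_of_ne hcon.2.symm] at h₂
    rcases Int.units_eq_one_or (τ (D.circleAt s (x, 0))) with h | h <;> rw [h] at h₂ <;>
      simp at h₂
  have h₃ : τ (D.circleAt s (x, 0)) = 1 := by
    have : ((minusAt c₀ (D.circleAt t (x, 0)) : ℤˣ) + (minusAt c₀ (D.circleAt t (x, 2)) : ℤˣ) : ℤ)
        = 0 := by
      rw [units_add_eq_zero_iff]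
      rcases hc₀ with rfl | rfl
      · exact Or.inl ⟨minusAt_self _, minusAt_of_ne hne.symm⟩
      · exact Or.inr ⟨minusAt_of_ne hne, minusAt_self _⟩
    rw [this] at h₂
    rcases Int.units_eq_one_or (τ (D.circleAt s (x, 0))) with h | h
    · exact h
    · rw [h] at h₂
      simp at h₂
  -- The only minus sign was created by the split, so the source has none.
  have hτ : τ = 1 := by
    funext c
    obtain ⟨e, rfl⟩ := mergeMap_surjective hsx hts hb c
    have hx := circleAt_ends_eq hsx hts hb 2 0
    by_cases h0 : e = D.circleAt t (x, 0)
    · rw [h0, mergeMap_circleAt, h₃, Pi.one_apply]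
    by_cases h2 : e = D.circleAt t (x, 2)
    · rw [h2, mergeMap_circleAt, hx, h₃, Pi.one_apply]
    rw [← h₁ e h0 h2, Pi.one_apply]
    refine minusAt_of_ne ?_
    rintro rfl
    exact hc₀.elim h0 h2
  subst hτ
  have hadj (c) : D.AdjacentAt ⟨s, 1⟩ ⟨t, minusAt c⟩ x ↔
      c = D.circleAt t (x, 0) ∨ c = D.circleAt t (x, 2) := by
    rw [adjacentAt_one_iff hsx hts hb, minusAt_injective.eq_iff, minusAt_injective.eq_iff]
  simp only [hadj]
  rw [← Finset.sum_filter, Finset.filter_or, Finset.filter_eq', Finset.filter_eq',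
    if_pos (Finset.mem_univ _), if_pos (Finset.mem_univ _), Finset.sum_union (by simpa using hne),
    Finset.sum_singleton, Finset.sum_singleton]
  exact ⟨_, rfl⟩

/-- If all red scars of a Kauffman state are bichords, the sum of the coefficients of a boundary at
the enhancements with exactly one negative circle is even. -/
theorem even_sum_diff {t : KauffmanState X} (ht : ∀ x, t x = Label.B → D.IsBichord t x)
    (z : D.Chain) : Even (∑ c, D.diff z ⟨t, minusAt c⟩) := by
  simp only [diff_apply, Finsupp.sum]
  rw [Finset.sum_comm]
  refine Finset.even_sum _ fun s _ => ?_
  rw [← Finset.mul_sum]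
  exact (even_sum_incidence ht s).mul_left _

end Boundary

/-! ## Steps of ladders -/

/-- The position of the lower left end is fixed by `s`, but it describes every state `t`: a blue
step runs along the two sides, a red one turns back above and below. -/
theorem smooth_of_isLowerLeft {s t : KauffmanState X} {d : Dart X} (hd : IsLowerLeft s d) :
    (t d.1 = Label.A → smooth t d = rot (rot (rot d)) ∧ smooth t (rot d) = rot (rot d) ∧
      smooth t (rot (rot d)) = rot d ∧ smooth t (rot (rot (rot d))) = d) ∧
    (t d.1 = Label.B → smooth t d = rot d ∧ smooth t (rot d) = d ∧
      smooth t (rot (rot d)) = rot (rot (rot d)) ∧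
      smooth t (rot (rot (rot d))) = rot (rot d)) := by
  obtain ⟨x, p⟩ := d
  obtain ⟨hA, hd⟩ := hd
  simp only at hA
  simp only [smooth, hA, rot, Prod.mk.injEq, true_and] at hd
  simp only [smooth, rot, Prod.mk.injEq, true_and]
  constructor <;> intro h <;> rw [h] <;> revert hd <;> clear h <;> revert p <;> decide

theorem eq_one_or_three_of_isLowerLeft {s : KauffmanState X} {d : Dart X}
    (hd : IsLowerLeft s d) : d = (d.1, 1) ∨ d = (d.1, 3) := by
  obtain ⟨x, p⟩ := d
  obtain ⟨hA, hd⟩ := hd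
  simp only at hA
  simp only [smooth, hA, rot, Prod.mk.injEq, true_and] at hd
  simp only [Prod.mk.injEq, true_and]
  revert hd
  revert p
  decide

theorem eq_rot_of_fst_eq {d e : Dart X} (h : e.1 = d.1) :
    e = d ∨ e = rot d ∨ e = rot (rot d) ∨ e = rot (rot (rot d)) := by
  obtain ⟨x, p⟩ := d
  obtain ⟨y, q⟩ := e
  obtain rfl : y = x := h
  simp only [rot, Prod.mk.injEq, true_and]
  revert p q
  decide

theorem rot_ne (d : Dart X) : d ≠ rot d ∧ d ≠ rot (rot d) ∧ d ≠ rot (rot (rot d)) := by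
  obtain ⟨x, p⟩ := d
  simp only [rot, ne_eq, Prod.mk.injEq, true_and]
  revert p
  decide

namespace Ladder

variable {s t : KauffmanState X} (H : Ladder D s)

/-- The left sides of a ladder between its steps, from the part above the first step to the part
below the last one, each one given by an end on it. -/
def level : ℕ → Dart X
  | 0 => H.top
  -- The value past the height is a dummy.
  | p + 1 => if h : p < H.height then H.step ⟨p, h⟩ else H.top

theorem level_succ (a : Fin H.height) : H.level (a + 1) = H.step a := by
  simp [level]

theorem level_height : H.level H.height = H.bottom := by
  obtain ⟨n, hn⟩ : ∃ n, H.height = n + 1 := ⟨H.height - 1, by have := H.height_pos; omega⟩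
  simp only [bottom, hn]
  simp [level, hn]

theorem circleAt_level (a : Fin H.height) :
    D.circleAt t (H.level a) = D.circleAt t (rot (rot (rot (H.step a)))) := by
  obtain ⟨n, hn⟩ := a
  cases n with
  | zero => rfl
  | succ n =>
    have h := H.level_succ ⟨n, by omega⟩
    simp only at h ⊢
    rw [h, ← (H.parallel ⟨n, by omega⟩ ⟨n + 1, hn⟩ rfl).1, circleAt_edge]

theorem circleAt_rot_step {a b : Fin H.height} (h : (b : ℕ) = a + 1) :
    D.circleAt t (rot (H.step a)) = D.circleAt t (rot (rot (H.step b))) := by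
  rw [← (H.parallel a b h).2, circleAt_edge]

theorem circleAt_of_blue {a : Fin H.height} (ha : t (H.crossing a) = Label.A) :
    D.circleAt t (rot (rot (rot (H.step a)))) = D.circleAt t (H.step a) ∧
      D.circleAt t (rot (rot (H.step a))) = D.circleAt t (rot (H.step a)) := by
  have h := (smooth_of_isLowerLeft (H.blue a)).1 ha
  rw [← h.1, ← h.2.1, circleAt_smooth, circleAt_smooth]
  exact ⟨rfl, rfl⟩

theorem circleAt_of_red {a : Fin H.height} (ha : t (H.crossing a) = Label.B) :
    D.circleAt t (rot (H.step a)) = D.circleAt t (H.step a) ∧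
      D.circleAt t (rot (rot (H.step a))) = D.circleAt t (rot (rot (rot (H.step a)))) := by
  have h := (smooth_of_isLowerLeft (H.blue a)).2 ha
  have h₁ := circleAt_smooth (D := D) (s := t) (H.step a)
  have h₂ := circleAt_smooth (D := D) (s := t) (rot (rot (H.step a)))
  rw [h.1] at h₁
  rw [h.2.2.1] at h₂
  exact ⟨h₁, h₂.symm⟩

theorem circleAt_level_of_blue {a : Fin H.height} (ha : t (H.crossing a) = Label.A) :
    D.circleAt t (H.level a) = D.circleAt t (H.level (a + 1)) := by
  rw [circleAt_level, level_succ, (H.circleAt_of_blue ha).1]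

/-- If some step of the ladder is red, the left and right sides of the ladder lie on the same circle
at each height. -/
theorem circleAt_rot_of_red {b : Fin H.height} (hb : t (H.crossing b) = Label.B)
    (a : Fin H.height) : D.circleAt t (rot (H.step a)) = D.circleAt t (H.step a) ∧
      D.circleAt t (rot (rot (H.step a))) = D.circleAt t (rot (rot (rot (H.step a)))) := by
  -- Across a blue step both sides continue; across a red one both equalities hold. Edges carry the
  -- property from one step to the next, so it holds everywhere once it holds at the red step `b`.
  have hiff (c : Fin H.height) : D.circleAt t (rot (H.step c)) = D.circleAt t (H.step c) ↔
      D.circleAt t (rot (rot (H.step c))) = D.circleAt t (rot (rot (rot (H.step c)))) := by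
    cases hc : t (H.crossing c) with
    | A => rw [(H.circleAt_of_blue hc).1, (H.circleAt_of_blue hc).2]
    | B => simp [H.circleAt_of_red hc]
  have hstep (c c' : Fin H.height) (h : (c' : ℕ) = c + 1) :
      D.circleAt t (rot (H.step c)) = D.circleAt t (H.step c) ↔
      D.circleAt t (rot (H.step c')) = D.circleAt t (H.step c') := by
    rw [hiff c', ← H.circleAt_level c', h, H.level_succ c, H.circleAt_rot_step h]
  have hzero (n : ℕ) (hn : n < H.height) :
      D.circleAt t (rot (H.step ⟨n, hn⟩)) = D.circleAt t (H.step ⟨n, hn⟩) ↔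
      D.circleAt t (rot (H.step ⟨0, H.height_pos⟩)) = D.circleAt t (H.step ⟨0, H.height_pos⟩) := by
    induction n with
    | zero => rfl
    | succ n ih => rw [← hstep ⟨n, by omega⟩ ⟨n + 1, hn⟩ rfl, ih]
  have ha : D.circleAt t (rot (H.step a)) = D.circleAt t (H.step a) := by
    rw [hzero a a.2, ← hzero b b.2]
    exact (H.circleAt_of_red hb).1
  exact ⟨ha, (hiff a).mp ha⟩

theorem step_eq_iff {a b : Fin H.height} : (H.step a).1 = (H.step b).1 ↔ a = b :=
  H.injective.eq_iff

/-- The ends on the part of a ladder between its steps `a` and `b`. -/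
def Between (a b : Fin H.height) (d : Dart X) : Prop :=
  ∃ c, a ≤ c ∧ c < b ∧ (d = H.step c ∨ d = rot (H.step c)) ∨
    a < c ∧ c ≤ b ∧ (d = rot (rot (H.step c)) ∨ d = rot (rot (rot (H.step c))))

/-- The red steps `a` and `b` close off the part of the ladder between them, so this part is a union
of whole circles. -/
theorem Between.of_circleAt_eq {a b : Fin H.height} (ha : t (H.crossing a) = Label.B)
    (hb : t (H.crossing b) = Label.B) {d d' : Dart X} (h : D.circleAt t d = D.circleAt t d')
    (hd : H.Between a b d) : H.Between a b d' := by
  refine LinkDiagram.of_circleAt_eq (H.Between a b) ?_ ?_ h hd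
  · rintro d ⟨c, ⟨hac, hcb, hd⟩ | ⟨hac, hcb, hd⟩⟩
    · have hc : (c : ℕ) + 1 < H.height := by have := b.2; omega
      have hp := H.parallel c ⟨c + 1, hc⟩ rfl
      refine ⟨⟨c + 1, hc⟩, Or.inr ⟨?_, ?_, ?_⟩⟩
      · rw [Fin.lt_def]; simp only; omega
      · rw [Fin.le_def]; simp only; omega
      · rcases hd with rfl | rfl
        · exact Or.inr hp.1
        · exact Or.inl hp.2
    · have hc : (c : ℕ) - 1 < H.height := by omega
      have hp := H.parallel ⟨c - 1, hc⟩ c (by simp only; omega)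
      refine ⟨⟨c - 1, hc⟩, Or.inl ⟨?_, ?_, ?_⟩⟩
      · rw [Fin.le_def]; simp only; omega
      · rw [Fin.lt_def]; simp only; omega
      · rcases hd with rfl | rfl
        · exact Or.inr (by rw [← hp.2, D.edge_edge])
        · exact Or.inl (by rw [← hp.1, D.edge_edge])
  · rintro d ⟨c, hd⟩
    have hs := smooth_of_isLowerLeft (t := t) (H.blue c)
    refine ⟨c, ?_⟩
    cases hc : t (H.crossing c) with
    | A =>
      have hca : c ≠ a := by rintro rfl; simp [ha] at hc
      have hcb : c ≠ b := by rintro rfl; simp [hb] at hc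
      have hs := hs.1 hc
      rcases hd with ⟨h1, h2, hd⟩ | ⟨h1, h2, hd⟩
      · refine Or.inr ⟨lt_of_le_of_ne h1 hca.symm, h2.le, ?_⟩
        rcases hd with rfl | rfl
        · exact Or.inr hs.1
        · exact Or.inl hs.2.1
      · refine Or.inl ⟨h1.le, lt_of_le_of_ne h2 hcb, ?_⟩
        rcases hd with rfl | rfl
        · exact Or.inr hs.2.2.1
        · exact Or.inl hs.2.2.2
    | B =>
      have hs := hs.2 hc
      rcases hd with ⟨h1, h2, hd⟩ | ⟨h1, h2, hd⟩
      · refine Or.inl ⟨h1, h2, ?_⟩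
        rcases hd with rfl | rfl
        · exact Or.inr hs.1
        · exact Or.inl hs.2.1
      · refine Or.inr ⟨h1, h2, ?_⟩
        rcases hd with rfl | rfl
        · exact Or.inr hs.2.2.1
        · exact Or.inl hs.2.2.2

theorem between_step_iff {a b c : Fin H.height} : H.Between a b (H.step c) ↔ a ≤ c ∧ c < b := by
  constructor
  · rintro ⟨c', ⟨h1, h2, hd⟩ | ⟨h1, h2, hd⟩⟩
    · have : c = c' := H.step_eq_iff.mp (by rcases hd with h | h <;> simp [h, rot])
      exact this ▸ ⟨h1, h2⟩
    · have : c = c' := H.step_eq_iff.mp (by rcases hd with h | h <;> simp [h, rot])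
      subst this
      exact (hd.elim (rot_ne _).2.1 (rot_ne _).2.2).elim
  · exact fun h => ⟨c, Or.inl ⟨h.1, h.2, Or.inl rfl⟩⟩

theorem between_rot_step_iff {a b c : Fin H.height} :
    H.Between a b (rot (rot (rot (H.step c)))) ↔ a < c ∧ c ≤ b := by
  constructor
  · rintro ⟨c', ⟨h1, h2, hd⟩ | ⟨h1, h2, hd⟩⟩
    · have : c = c' := H.step_eq_iff.mp (by
        rcases hd with h | h <;> exact (congrArg Prod.fst h :))
      subst this
      exact (hd.elim (rot_ne _).2.2.symm (rot_ne (rot (H.step c))).2.1.symm).elim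
    · have : c = c' := H.step_eq_iff.mp (by
        rcases hd with h | h <;> exact (congrArg Prod.fst h :))
      exact this ▸ ⟨h1, h2⟩
  · exact fun h => ⟨c, Or.inr ⟨h.1, h.2, Or.inr rfl⟩⟩

/-- The circles that touch a red step from above and from below are different if the ladder has
another red step. -/
theorem circleAt_level_ne {a b : Fin H.height} (hab : a ≠ b) (ha : t (H.crossing a) = Label.B)
    (hb : t (H.crossing b) = Label.B) :
    D.circleAt t (H.level a) ≠ D.circleAt t (H.level (a + 1)) := by
  rw [circleAt_level, level_succ]
  intro h
  -- Exactly one side of step `a` lies in the closed-off part between `a` and `b`.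
  rcases lt_or_gt_of_ne hab with hlt | hlt
  · have := Between.of_circleAt_eq H ha hb h.symm (H.between_step_iff.mpr ⟨le_rfl, hlt⟩)
    exact absurd (H.between_rot_step_iff.mp this).1 (lt_irrefl _)
  · have := Between.of_circleAt_eq H hb ha h (H.between_rot_step_iff.mpr ⟨hlt, le_rfl⟩)
    exact absurd (H.between_step_iff.mp this).2 (lt_irrefl _)

/-- The two circles touched by a red step. -/
theorem circleAt_red_step {a : Fin H.height} (ha : t (H.crossing a) = Label.B) :
    D.circleAt t (H.level a) = D.circleAt t (H.crossing a, 0) ∧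
      D.circleAt t (H.level (a + 1)) = D.circleAt t (H.crossing a, 2) ∨
    D.circleAt t (H.level a) = D.circleAt t (H.crossing a, 2) ∧
      D.circleAt t (H.level (a + 1)) = D.circleAt t (H.crossing a, 0) := by
  have hB := circleAt_B (D := D) ha
  rw [circleAt_level, level_succ]
  have hc : H.crossing a = (H.step a).1 := rfl
  rcases eq_one_or_three_of_isLowerLeft (H.blue a) with h | h <;>
    rw [← hc] at h <;> rw [h]
  · exact Or.inl ⟨congrArg _ (Prod.ext rfl (by simp only [rot]; decide)), hB.1⟩
  · exact Or.inr ⟨congrArg _ (Prod.ext rfl (by simp only [rot]; decide)), hB.2⟩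

end Ladder

/-! ## Reddening steps of ladders -/

section Redden

variable {X : Type*} {D : LinkDiagram X} {s₀ : KauffmanState X} {k : ℕ}
  {H : Fin k → Ladder D s₀}

theorem IsGrouping.crossing_injective (hg : IsGrouping H) :
    Function.Injective fun p : Σ l, Fin (H l).height => (H p.1).crossing p.2 := by
  rintro ⟨l, a⟩ ⟨l', a'⟩ h
  obtain rfl : l = l' := hg.2 _ _ _ _ h
  exact Sigma.ext rfl (heq_of_eq ((H l).injective h))

theorem redden_crossing (hg : IsGrouping H) (N : ∀ l, Finset (Fin (H l).height)) (l : Fin k)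
    (a : Fin (H l).height) :
    redden H N ((H l).crossing a) = if a ∈ N l then Label.B else Label.A := by
  by_cases ha : a ∈ N l
  · rw [if_pos ha]
    exact if_pos ⟨l, a, ha, rfl⟩
  · rw [if_neg ha]
    refine (if_neg ?_).trans ((H l).blue a).1
    rintro ⟨l', a', ha', h⟩
    obtain rfl := hg.2 _ _ _ _ h
    exact ha ((H l').injective h ▸ ha')

theorem redden_eq_A_iff (hg : IsGrouping H) (N : ∀ l, Finset (Fin (H l).height)) (x : X) :
    redden H N x = Label.A ↔ ∃ l, ∃ a ∉ N l, (H l).crossing a = x := by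
  constructor
  · intro h
    have hx : s₀ x = Label.A := by
      unfold redden at h
      split_ifs at h
      exact h
    obtain ⟨l, a, rfl⟩ := hg.1 x hx
    refine ⟨l, a, fun ha => ?_, rfl⟩
    rw [redden_crossing hg, if_pos ha] at h
    exact absurd h (by decide)
  · rintro ⟨l, a, ha, rfl⟩
    rw [redden_crossing hg, if_neg ha]

theorem redden_of_ne (hg : IsGrouping H) (N : ∀ l, Finset (Fin (H l).height)) {x : X}
    (hx : ∀ l a, (H l).crossing a ≠ x) : redden H N x = Label.B := by
  cases h : redden H N x with
  | A =>
    obtain ⟨l, a, -, h⟩ := (redden_eq_A_iff hg N x).mp h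
    exact absurd h (hx l a)
  | B => rfl

theorem redden_injective (hg : IsGrouping H) : Function.Injective (redden H) := by
  intro N M h
  funext l
  ext a
  have := congrFun h ((H l).crossing a)
  rw [redden_crossing hg, redden_crossing hg] at this
  by_cases h1 : a ∈ N l <;> by_cases h2 : a ∈ M l <;> simp_all

theorem redden_insert [DecidableEq X] (hg : IsGrouping H) (N : ∀ l, Finset (Fin (H l).height))
    (l : Fin k) (a : Fin (H l).height) :
    redden H (Function.update N l (insert a (N l))) =
      Function.update (redden H N) ((H l).crossing a) Label.B := by
  funext x
  by_cases hx : ∃ l' a', (H l').crossing a' = x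
  · obtain ⟨l', a', rfl⟩ := hx
    rw [redden_crossing hg]
    by_cases hl : l' = l
    · subst hl
      rw [Function.update_self]
      by_cases ha : a' = a
      · simp [ha]
      · have hne : (H l').crossing a' ≠ (H l').crossing a := fun h => ha ((H l').injective h)
        rw [Function.update_of_ne hne, redden_crossing hg]
        simp [ha]
    · rw [Function.update_of_ne hl, Function.update_of_ne fun h => hl (hg.2 _ _ _ _ h),
        redden_crossing hg]
  · push Not at hx
    rw [redden_of_ne hg _ hx, Function.update_of_ne (hx l a).symm, redden_of_ne hg _ hx]

theorem update_erase_insert {N : ∀ l, Finset (Fin (H l).height)} {l : Fin k}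
    {a : Fin (H l).height} (ha : a ∈ N l) :
    Function.update (Function.update N l ((N l).erase a)) l
      (insert a (Function.update N l ((N l).erase a) l)) = N := by
  simp [Finset.insert_erase ha]

theorem redden_eq_update [DecidableEq X] (hg : IsGrouping H)
    {N : ∀ l, Finset (Fin (H l).height)} {l : Fin k} {a : Fin (H l).height} (ha : a ∈ N l) :
    redden H (Function.update N l ((N l).erase a)) ((H l).crossing a) = Label.A ∧
    redden H N = Function.update (redden H (Function.update N l ((N l).erase a)))
      ((H l).crossing a) Label.B := by
  rw [← redden_insert hg, update_erase_insert ha, redden_crossing hg]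
  simp

/-! ### Circles -/

/-- A red step in a ladder puts its left and right sides on one circle at each height. Turning back
at further red steps then joins only ends that were already on the same circle. -/
theorem circleAt_eq_of_redden_univ (hg : IsGrouping H) {N : ∀ l, Finset (Fin (H l).height)}
    (hN : ∀ l, (N l).Nonempty) {d d' : Dart X}
    (h : D.circleAt (redden H fun _ => Finset.univ) d =
      D.circleAt (redden H fun _ => Finset.univ) d') :
    D.circleAt (redden H N) d = D.circleAt (redden H N) d' := by
  refine eq_of_circleAt_eq (fun d => D.circleAt (redden H N) d) (fun d => circleAt_edge d)
    (fun d => ?_) h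
  by_cases hd : ∃ l a, (H l).crossing a = d.1
  · obtain ⟨l, a, ha⟩ := hd
    obtain ⟨b, hb⟩ := hN l
    have hr := (H l).circleAt_rot_of_red (t := redden H N) (b := b)
      (by rw [redden_crossing hg, if_pos hb]) a
    have hs := (smooth_of_isLowerLeft (t := redden H fun _ => Finset.univ) ((H l).blue a)).2
      ((redden_crossing hg _ _ _).trans (if_pos (Finset.mem_univ a)))
    rcases eq_rot_of_fst_eq (d := (H l).step a) (e := d) ha.symm with rfl | rfl | rfl | rfl
    · rw [hs.1, hr.1]
    · rw [hs.2.1, hr.1]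
    · rw [hs.2.2.1, hr.2]
    · rw [hs.2.2.2, hr.2]
  · push Not at hd
    have : smooth (redden H fun _ => Finset.univ) d = smooth (redden H N) d := by
      rw [smooth, smooth, redden_of_ne hg _ hd, redden_of_ne hg _ hd]
    simp only [this, circleAt_smooth]

variable (hp : ∀ l, peripheryNumber H l = 1)
include hp

/-- Periphery numbers are defined in the completely cut state; here they are carried to any state
with a red step in each ladder. -/
theorem circleAt_top_eq_bottom (hg : IsGrouping H) {N : ∀ l, Finset (Fin (H l).height)}
    (hN : ∀ l, (N l).Nonempty) (l : Fin k) :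
    D.circleAt (redden H N) (H l).top = D.circleAt (redden H N) (H l).bottom := by
  refine circleAt_eq_of_redden_univ hg hN ?_
  by_contra h
  have := hp l
  rw [peripheryNumber, periphery, Set.ncard_pair h] at this
  omega

/-- Blue steps connect everything above the red step to the top and everything below it to the
bottom; periphery number one connects top and bottom. -/
theorem circleAt_singleton_step (hg : IsGrouping H) (c : ∀ l, Fin (H l).height) (l : Fin k)
    (p : ℕ) (hle : p ≤ (H l).height) :
    D.circleAt (redden H fun l => {c l}) ((H l).level p) =
      D.circleAt (redden H fun l => {c l}) (H l).top := by
  have hblue (n : ℕ) (hn : n < (H l).height) (hc : n ≠ c l) :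
      D.circleAt (redden H fun l => {c l}) ((H l).level n) =
      D.circleAt (redden H fun l => {c l}) ((H l).level (n + 1)) :=
    (H l).circleAt_level_of_blue (a := ⟨n, hn⟩) (by
      rw [redden_crossing hg, if_neg]
      simpa [Fin.ext_iff] using hc)
  by_cases hpc : p ≤ c l
  · induction p with
    | zero => rfl
    | succ n ih => rw [← hblue n (by omega) (by omega), ih (by omega) (by omega)]
  · rw [circleAt_top_eq_bottom hp hg (fun l => Finset.singleton_nonempty (c l)),
      ← Ladder.level_height]
    induction hle using Nat.decreasingInduction with
    | self => rfl
    | of_succ n hn ih => rw [hblue n (by omega) (by omega), ih (by omega)]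

/-- A Kauffman state with exactly one red step in each ladder has the coarsest circles. -/
theorem circleAt_singleton_eq (hg : IsGrouping H) (N : ∀ l, Finset (Fin (H l).height))
    (c : ∀ l, Fin (H l).height) {d d' : Dart X}
    (h : D.circleAt (redden H N) d = D.circleAt (redden H N) d') :
    D.circleAt (redden H fun l => {c l}) d = D.circleAt (redden H fun l => {c l}) d' := by
  refine eq_of_circleAt_eq (fun d => D.circleAt (redden H fun l => {c l}) d)
    (fun d => circleAt_edge d) (fun d => ?_) h
  by_cases hd : ∃ l a, (H l).crossing a = d.1
  · obtain ⟨l, a, ha⟩ := hd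
    -- All four ends of a ladder crossing lie on one circle, so the way `N` smooths it is
    -- irrelevant.
    have hall (e : Dart X) (he : e.1 = d.1) : D.circleAt (redden H fun l => {c l}) e =
        D.circleAt (redden H fun l => {c l}) (H l).top := by
      have hr := (H l).circleAt_rot_of_red (t := redden H fun l => {c l}) (b := c l)
        (by simp [redden_crossing hg]) a
      have h1 := circleAt_singleton_step hp hg c l (a + 1) a.2
      have h0 := circleAt_singleton_step hp hg c l a a.2.le
      rw [Ladder.level_succ] at h1
      rw [Ladder.circleAt_level] at h0
      rcases eq_rot_of_fst_eq (d := (H l).step a) (e := e) (he.trans ha.symm) with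
        rfl | rfl | rfl | rfl
      · exact h1
      · exact hr.1.trans h1
      · exact hr.2.trans h0
      · exact h0
    exact (hall (smooth (redden H N) d) rfl).trans (hall d rfl).symm
  · push Not at hd
    have : smooth (redden H N) d = smooth (redden H fun l => {c l}) d := by
      rw [smooth, smooth, redden_of_ne hg _ hd, redden_of_ne hg _ hd]
    simp only [this, circleAt_smooth]

omit hp in
theorem isBichord_step (hg : IsGrouping H) {N : ∀ l, Finset (Fin (H l).height)} {l : Fin k}
    (hN : 2 ≤ (N l).card) {a : Fin (H l).height} (ha : a ∈ N l) :
    D.IsBichord (redden H N) ((H l).crossing a) := by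
  obtain ⟨b, hb, hba⟩ := Finset.exists_mem_ne (show 1 < (N l).card by omega) a
  have ha' : redden H N ((H l).crossing a) = Label.B := by rw [redden_crossing hg, if_pos ha]
  have hb' : redden H N ((H l).crossing b) = Label.B := by rw [redden_crossing hg, if_pos hb]
  have := (H l).circleAt_level_ne hba.symm ha' hb'
  unfold IsBichord
  rcases (H l).circleAt_red_step ha' with h | h
  · rwa [h.1, h.2] at this
  · rw [h.1, h.2] at this
    exact this.symm

/-- A red step is a bichord because of a second red step in its ladder. An old red scar is one
because its two circles are different even in the coarser state with one red step per ladder. -/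
theorem isBichord_redden (hg : IsGrouping H) {c : ∀ l, Fin (H l).height}
    (hb : ∀ x, s₀ x = Label.B → D.IsBichord (redden H fun l => {c l}) x)
    {N : ∀ l, Finset (Fin (H l).height)} (hN : ∀ l, 2 ≤ (N l).card) {x : X}
    (hx : redden H N x = Label.B) : D.IsBichord (redden H N) x := by
  by_cases h : ∃ l a, (H l).crossing a = x
  · obtain ⟨l, a, rfl⟩ := h
    refine isBichord_step hg (hN l) ?_
    by_contra ha
    rw [redden_crossing hg, if_neg ha] at hx
    exact absurd hx (by decide)
  · have hs : s₀ x = Label.B := by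
      cases hs : s₀ x with
      | A => exact absurd (hg.1 x hs) h
      | B => rfl
    exact fun heq => hb x hs (circleAt_singleton_eq hp hg N c heq)

/-- Induction on the number of red steps: one of several red steps in a ladder is a bichord, and
making it blue merges two circles. With one red step per ladder, all choices give the same partition
into circles. -/
theorem numCircles_redden [Finite X] (hg : IsGrouping H) (c : ∀ l, Fin (H l).height)
    (N : ∀ l, Finset (Fin (H l).height)) (hN : ∀ l, (N l).Nonempty) :
    D.numCircles (redden H N) + k =
      D.numCircles (redden H fun l => {c l}) + ∑ l, (N l).card := by
  classical
  induction hn : ∑ l, (N l).card using Nat.strong_induction_on generalizing N with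
  | _ n ih =>
  by_cases h : ∃ l, 2 ≤ (N l).card
  · obtain ⟨l, hl⟩ := h
    obtain ⟨a, ha⟩ := hN l
    obtain ⟨h1, h2⟩ := redden_eq_update hg ha
    have h3 := numCircles_eq_add_one h1 h2 (isBichord_step hg hl ha)
    have hcard : ∑ l', (Function.update N l ((N l).erase a) l').card + 1 = n := by
      rw [← hn, ← Finset.sum_erase_add _ _ (Finset.mem_univ l),
        ← Finset.sum_erase_add (a := l) _ (fun l => (N l).card) (Finset.mem_univ l),
        Function.update_self, Finset.card_erase_of_mem ha, add_assoc,
        Nat.sub_add_cancel (by omega)]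
      congr 1
      refine Finset.sum_congr rfl fun l' hl' => ?_
      rw [Function.update_of_ne (Finset.ne_of_mem_erase hl')]
    have h4 := ih _ (by omega) (Function.update N l ((N l).erase a)) (fun l' => by
      by_cases hl' : l' = l
      · subst hl'
        rw [Function.update_self, ← Finset.card_pos, Finset.card_erase_of_mem ha]
        omega
      · rw [Function.update_of_ne hl']
        exact hN l') rfl
    omega
  · push Not at h
    have h1 (l) : ∃ a, N l = {a} := by
      rw [← Finset.card_eq_one]
      have := (hN l).card_pos
      have := h l
      omega
    choose b hb using h1
    obtain rfl : N = fun l => {b l} := funext hb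
    have : D.circleSetoid (redden H fun l => {b l}) = D.circleSetoid (redden H fun l => {c l}) := by
      ext d d'
      have h1 : D.circleAt (redden H fun l => {b l}) d = D.circleAt (redden H fun l => {b l}) d' ↔
          D.circleAt (redden H fun l => {c l}) d = D.circleAt (redden H fun l => {c l}) d' :=
        ⟨circleAt_singleton_eq hp hg _ c, circleAt_singleton_eq hp hg _ b⟩
      simpa only [circleAt, Sum.inl.injEq, Quotient.eq] using h1
    unfold numCircles Circle
    rw [this, ← hn]
    simp

end Redden

/-! ## The differential of chains of reddened states -/

section Telescope

/-- Put F(p) = (-1)^(number of elements of S below p) · G(p). The difference F(a) - F(a+1) is the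
summand if a ∈ S, since the sign flips, and 0 otherwise. -/
theorem sum_alternating_telescope {n : ℕ} (S : Finset (Fin n)) (G : ℕ → ℤ)
    (hG : ∀ a : Fin n, a ∉ S → G a = G (a + 1)) :
    ∑ a ∈ S, (-1 : ℤ) ^ (S.filter (· < a)).card * (G a + G (a + 1)) =
      G 0 - (-1) ^ S.card * G n := by
  have h := Finset.sum_range_sub'
    (fun p : ℕ => (-1 : ℤ) ^ (S.filter fun b : Fin n => (b : ℕ) < p).card * G p) n
  have h0 : (S.filter fun b : Fin n => (b : ℕ) < 0).card = 0 := by simp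
  have hn : S.filter (fun b : Fin n => (b : ℕ) < n) = S := Finset.filter_true_of_mem (by simp)
  rw [h0, hn, pow_zero, one_mul] at h
  rw [← h, Finset.sum_range, ← Finset.sum_filter_add_sum_filter_not Finset.univ (· ∈ S)]
  simp only [Finset.filter_univ_mem]
  rw [Finset.sum_eq_zero (s := Finset.univ.filter (· ∉ S)), add_zero]
  · refine Finset.sum_congr rfl fun a ha => ?_
    have : S.filter (fun b : Fin n => (b : ℕ) < a + 1) =
        insert a (S.filter fun b : Fin n => (b : ℕ) < a) := by
      ext b
      simp only [Finset.mem_filter, Finset.mem_insert, Fin.ext_iff]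
      constructor
      · rintro ⟨hb, hlt⟩
        by_cases h : (b : ℕ) = a
        · exact Or.inl h
        · exact Or.inr ⟨hb, by omega⟩
      · rintro (hb | ⟨hb, hlt⟩)
        · exact ⟨Fin.ext hb ▸ ha, by omega⟩
        · exact ⟨hb, by omega⟩
    rw [this, Finset.card_insert_of_notMem (by simp), pow_succ]
    simp only [Fin.lt_def]
    ring
  · intro a ha
    have ha : a ∉ S := by simpa using ha
    have : S.filter (fun b : Fin n => (b : ℕ) < a + 1) =
        S.filter fun b : Fin n => (b : ℕ) < a := by
      refine Finset.filter_congr fun b hb => ?_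
      have : (b : ℕ) ≠ a := fun h => ha (Fin.ext h ▸ hb)
      omega
    rw [this, hG a ha, sub_self]

theorem update_add_one_symm {ι : Type*} [DecidableEq ι] (μ : ι → ℕ) {i l : ι} (h : i ≠ l) :
    Function.update (Function.update μ i (1 + μ i)) l (Function.update μ i (1 + μ i) l + 1) =
      Function.update (Function.update μ l (1 + μ l)) i (Function.update μ l (1 + μ l) i + 1) := by
  rw [Function.update_of_ne h.symm, Function.update_of_ne h, Function.update_comm h,
    add_comm 1, add_comm 1]

/-- The extra red step in ladder `i` changes the sign at ladder `l` only if `i` comes first; the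
antisymmetry behind dV = 0 rests on this. -/
theorem sum_lt_update {k : ℕ} (μ : Fin k → ℕ) (i l : Fin k) :
    ∑ l' with l' < l, Function.update μ i (1 + μ i) l' =
      ∑ l' with l' < l, μ l' + if i < l then 1 else 0 := by
  split_ifs with h
  · have h1 := Finset.sum_sdiff (f := μ) (s₁ := {i}) (s₂ := Finset.univ.filter (· < l))
      (by simpa using h)
    rw [Finset.sum_singleton] at h1
    rw [Finset.sum_update_of_mem (by simpa using h)]
    omega
  · rw [Finset.sum_update_of_notMem (by simpa using h), add_zero]

theorem ite_or_eq_add {p q : Prop} [Decidable p] [Decidable q] [Decidable (p ∨ q)]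
    (h : p → ¬ q) :
    (if p ∨ q then (1 : ℤ) else 0) = (if p then 1 else 0) + if q then 1 else 0 := by
  by_cases hp : p <;> by_cases hq : q <;> simp_all

end Telescope

/-! ### Incidence numbers and differentials of reddened states. -/

section Chains

variable {X : Type*} [Fintype X] [LinearOrder X] {D : LinkDiagram X} {s₀ : KauffmanState X}
  {k : ℕ} {H : Fin k → Ladder D s₀}

/-- Crossings outside the ladders come last, so only red steps of earlier ladders and higher red
steps of the same ladder count. -/
theorem card_filter_lt_redden (hg : IsGrouping H) (ho : IsOrdered H)
    (N : ∀ l, Finset (Fin (H l).height)) (l : Fin k) (a : Fin (H l).height) :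
    (Finset.univ.filter fun y => y < (H l).crossing a ∧ redden H N y = Label.B).card =
      ∑ l' with l' < l, (N l').card + ((N l).filter (· < a)).card := by
  classical
  rw [Finset.card_filter, ← Fintype.sum_of_injective _ hg.crossing_injective
    (fun p : Σ l, Fin (H l).height =>
      if (H p.1).crossing p.2 < (H l).crossing a ∧ p.2 ∈ N p.1 then 1 else 0) _ ?_ ?_,
    Fintype.sum_sigma, Finset.sum_filter,
    ← Finset.sum_erase_add Finset.univ _ (Finset.mem_univ l),
    ← Finset.sum_erase_add Finset.univ (fun l' => if l' < l then (N l').card else 0)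
      (Finset.mem_univ l), if_neg (lt_irrefl l), add_zero]
  · congr 1
    · refine Finset.sum_congr rfl fun l' hl' => ?_
      rcases lt_or_gt_of_ne (Finset.ne_of_mem_erase hl') with h | h
      · rw [if_pos h]
        simp [ho.2.1 l' l _ a h]
      · rw [if_neg h.not_gt]
        simp [(ho.2.1 l l' a _ h).not_gt]
    · rw [← Finset.card_filter]
      congr 1
      ext b
      have : (H l).crossing b < (H l).crossing a ↔ b < a :=
        (show StrictMono (H l).crossing from fun b a h => ho.1 l b a h).lt_iff_lt
      simp [this, and_comm]
  · intro x hx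
    refine if_neg fun h => ?_
    have := ho.2.2 l a x fun l' a' h' => hx ⟨⟨l', a'⟩, h'⟩
    exact lt_asymm h.1 this
  · rintro ⟨l', a'⟩
    simp [redden_crossing hg]

theorem numRed_redden (hg : IsGrouping H) (N : ∀ l, Finset (Fin (H l).height)) :
    numRed (redden H N) = numRed s₀ + ∑ l, (N l).card := by
  classical
  have h1 : ∑ l, (N l).card =
      ∑ x, if s₀ x = Label.A ∧ redden H N x = Label.B then 1 else 0 := by
    rw [← Fintype.sum_of_injective _ hg.crossing_injective
      (fun p : Σ l, Fin (H l).height => if p.2 ∈ N p.1 then 1 else 0) _ ?_ ?_, Fintype.sum_sigma]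
    · refine Finset.sum_congr rfl fun l _ => ?_
      rw [← Finset.card_filter]
      congr 1
      ext a
      simp
    · intro x hx
      refine if_neg fun h => ?_
      obtain ⟨l, a, h⟩ := hg.1 x h.1
      exact hx ⟨⟨l, a⟩, h⟩
    · rintro ⟨l, a⟩
      have : s₀ ((H l).crossing a) = Label.A := ((H l).blue a).1
      simp [redden_crossing hg, this]
  rw [h1, numRed, numRed, Finset.card_filter, Finset.card_filter, ← Finset.sum_add_distrib]
  refine Finset.sum_congr rfl fun x _ => ?_
  cases hx : s₀ x with
  | A => simp
  | B =>
    have : redden H N x = Label.B := by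
      unfold redden
      split_ifs <;> simp [hx]
    simp [this]

/-- The choices of `ν l` steps of each ladder `H l`. -/
def choices (H : Fin k → Ladder D s₀) (ν : Fin k → ℕ) :
    Finset (∀ l, Finset (Fin (H l).height)) :=
  Fintype.piFinset fun l => Finset.powersetCard (ν l) Finset.univ

omit [Fintype X] [LinearOrder X] in
theorem mem_choices {ν : Fin k → ℕ} {N : ∀ l, Finset (Fin (H l).height)} :
    N ∈ choices H ν ↔ ∀ l, (N l).card = ν l := by
  simp [choices, Fintype.mem_piFinset, Finset.mem_powersetCard]

theorem eq_redden_of_adjacentAt (hg : IsGrouping H) {M : ∀ l, Finset (Fin (H l).height)}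
    {τ : D.Circle (redden H M) → ℤˣ} {t : D.EnhancedState} {x : X}
    (h : D.AdjacentAt ⟨redden H M, τ⟩ t x) : ∃ l, ∃ a ∉ M l, (H l).crossing a = x ∧
      t.1 = redden H (Function.update M l (insert a (M l))) := by
  obtain ⟨l, a, ha, rfl⟩ := (redden_eq_A_iff hg M x).mp h.label
  exact ⟨l, a, ha, rfl, h.labels.trans (redden_insert hg M l a).symm⟩

theorem incidence_eq_zero (hg : IsGrouping H) {M : ∀ l, Finset (Fin (H l).height)}
    {τ : D.Circle (redden H M) → ℤˣ} {t : D.EnhancedState} (ht : ∀ N, t.1 ≠ redden H N) :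
    D.incidence ⟨redden H M, τ⟩ t = 0 := by
  refine Finset.sum_eq_zero fun x _ => if_neg fun h => ?_
  obtain ⟨l, a, -, -, h⟩ := eq_redden_of_adjacentAt hg h
  exact ht _ h

-- The sources of a state with red steps `N` arise by making one red step `a` blue. The sign factors
-- into a part from the earlier ladders, constant along the ladder, and an alternating part within
-- it.
open Classical in
theorem sum_choices_incidence (hg : IsGrouping H) (ho : IsOrdered H)
    (τ : ∀ M, D.Circle (redden H M) → ℤˣ) (ν : Fin k → ℕ) (N : ∀ l, Finset (Fin (H l).height))
    (σ : D.Circle (redden H N) → ℤˣ) :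
    ∑ M ∈ choices H ν, D.incidence ⟨redden H M, τ M⟩ ⟨redden H N, σ⟩ =
      ∑ l, if N ∈ choices H (Function.update ν l (ν l + 1)) then
        (-1) ^ (∑ l' with l' < l, ν l') * ∑ a ∈ N l, (-1) ^ ((N l).filter (· < a)).card *
          if D.AdjacentAt ⟨redden H (Function.update N l ((N l).erase a)), τ _⟩
            ⟨redden H N, σ⟩ ((H l).crossing a) then 1 else 0
      else 0 := by
  have h1 (M : ∀ l, Finset (Fin (H l).height)) :
      D.incidence ⟨redden H M, τ M⟩ ⟨redden H N, σ⟩ = ∑ l, ∑ a : Fin (H l).height,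
        if D.AdjacentAt ⟨redden H M, τ M⟩ ⟨redden H N, σ⟩ ((H l).crossing a) then
          (-1) ^ (∑ l' with l' < l, (M l').card + ((M l).filter (· < a)).card) else 0 := by
    rw [incidence, ← Fintype.sum_of_injective _ hg.crossing_injective
      (fun p : Σ l, Fin (H l).height =>
        if D.AdjacentAt ⟨redden H M, τ M⟩ ⟨redden H N, σ⟩ ((H p.1).crossing p.2) then
          (-1 : ℤ) ^ (∑ l' with l' < p.1, (M l').card + ((M p.1).filter (· < p.2)).card) else 0)
        _ ?_ ?_, Fintype.sum_sigma]
    · intro x hx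
      refine if_neg fun h => ?_
      obtain ⟨l, a, -, h, -⟩ := eq_redden_of_adjacentAt hg h
      exact hx ⟨⟨l, a⟩, h⟩
    · rintro ⟨l, a⟩
      simp only [card_filter_lt_redden hg ho]
  simp only [h1]
  rw [Finset.sum_comm]
  refine Finset.sum_congr rfl fun l _ => ?_
  rw [Finset.sum_comm]
  have hM {M : ∀ l, Finset (Fin (H l).height)} {a : Fin (H l).height}
      (h : D.AdjacentAt ⟨redden H M, τ M⟩ ⟨redden H N, σ⟩ ((H l).crossing a)) :
      a ∈ N l ∧ M = Function.update N l ((N l).erase a) := by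
    obtain ⟨l', a', ha', hc, hN⟩ := eq_redden_of_adjacentAt hg h
    obtain rfl : l' = l := hg.2 _ _ _ _ hc
    obtain rfl : a' = a := (H l').injective hc
    obtain rfl := redden_injective hg hN
    simp [Finset.erase_insert ha']
  have hmem {a : Fin (H l).height} (ha : a ∈ N l) :
      Function.update N l ((N l).erase a) ∈ choices H ν ↔
        N ∈ choices H (Function.update ν l (ν l + 1)) := by
    rw [mem_choices, mem_choices]
    refine forall_congr' fun l' => ?_
    by_cases hl : l' = l
    · subst hl
      rw [Function.update_self, Function.update_self, Finset.card_erase_of_mem ha]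
      have := Finset.card_pos.mpr ⟨a, ha⟩
      omega
    · rw [Function.update_of_ne hl, Function.update_of_ne hl]
  split_ifs with hN
  · rw [Finset.mul_sum, ← Finset.sum_subset (Finset.subset_univ (N l))]
    · refine Finset.sum_congr rfl fun a ha => ?_
      rw [Finset.sum_eq_single (Function.update N l ((N l).erase a))]
      · have h2 : ∑ l' with l' < l, (Function.update N l ((N l).erase a) l').card =
            ∑ l' with l' < l, ν l' :=
          Finset.sum_congr rfl fun l' _ => mem_choices.mp ((hmem ha).mpr hN) l'
        have h3 : (Function.update N l ((N l).erase a) l).filter (· < a) =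
            (N l).filter (· < a) := by
          rw [Function.update_self, Finset.filter_erase]
          exact Finset.erase_eq_of_notMem (by simp)
        rw [h2, h3, pow_add]
        split_ifs <;> ring
      · exact fun M _ hne => if_neg fun h => hne (hM h).2
      · exact fun h => absurd ((hmem ha).mpr hN) h
    · exact fun a _ ha => Finset.sum_eq_zero fun M _ => if_neg fun h => ha (hM h).1
  · refine Finset.sum_eq_zero fun a _ => Finset.sum_eq_zero fun M hMν => if_neg fun h => hN ?_
    obtain ⟨ha, rfl⟩ := hM h
    exact (hmem ha).mp hMν

theorem diff_sum_single (ν : Fin k → ℕ) (E : (∀ l, Finset (Fin (H l).height)) → D.EnhancedState)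
    (t : D.EnhancedState) :
    D.diff (∑ M ∈ choices H ν, Finsupp.single (E M) 1) t =
      ∑ M ∈ choices H ν, D.incidence (E M) t := by
  rw [map_sum, Finsupp.finsetSum_apply]
  refine Finset.sum_congr rfl fun M _ => ?_
  rw [diff_apply, Finsupp.sum_single_index (by simp), one_mul]

omit [Fintype X] [LinearOrder X] in
theorem reddenMinus_eq (i : Fin k) (N : ∀ l, Finset (Fin (H l).height)) :
    reddenMinus H i N = ⟨redden H N, minusAt (D.circleAt _ (H i).top)⟩ := rfl

omit [Fintype X] [LinearOrder X] in
theorem chainMinus_eq (i : Fin k) (ν : Fin k → ℕ) : chainMinus H i ν =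
    ∑ M ∈ choices H ν, Finsupp.single (reddenMinus H i M) 1 := rfl

/-- The sum, over all choices of `ν l` steps of each ladder `H l`, of the enhanced states with all
circles positive. -/
noncomputable def chainPlus (H : Fin k → Ladder D s₀) (ν : Fin k → ℕ) : D.Chain :=
  ∑ M ∈ choices H ν, Finsupp.single ⟨redden H M, 1⟩ 1

variable (hp : ∀ l, peripheryNumber H l = 1)
include hp

omit [Fintype X] [LinearOrder X] in
/-- The contributions of the steps of one ladder cancel, except those of its extremes. -/
theorem sum_step_telescope (hg : IsGrouping H) {N : ∀ l, Finset (Fin (H l).height)}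
    (hN : ∀ l, (N l).Nonempty) (l : Fin k) (g : D.Circle (redden H N) → ℤ) :
    ∑ a ∈ N l, (-1) ^ ((N l).filter (· < a)).card *
      (g (D.circleAt _ ((H l).crossing a, 0)) + g (D.circleAt _ ((H l).crossing a, 2))) =
      (1 - (-1) ^ (N l).card) * g (D.circleAt _ (H l).top) := by
  -- The left side is followed from top to bottom; its circle changes only at red steps.
  have h := sum_alternating_telescope (N l) (fun p => g (D.circleAt _ ((H l).level p)))
    fun a ha => by
      rw [(H l).circleAt_level_of_blue (by rw [redden_crossing hg, if_neg ha])]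
  rw [Ladder.level_height, ← circleAt_top_eq_bottom hp hg hN] at h
  refine Eq.trans (Finset.sum_congr rfl fun a ha => ?_) (h.trans ?_)
  · rcases (H l).circleAt_red_step (t := redden H N) (a := a)
      (by rw [redden_crossing hg, if_pos ha]) with h' | h'
    · rw [h'.1, h'.2]
    · rw [h'.1, h'.2, add_comm (g _)]
  · rw [show (H l).level 0 = (H l).top from rfl]
    ring

open Classical in
theorem diff_chainPlus_apply (hg : IsGrouping H) (ho : IsOrdered H) {μ : Fin k → ℕ}
    (hμ : ∀ l, 1 ≤ μ l) (N : ∀ l, Finset (Fin (H l).height)) (σ : D.Circle (redden H N) → ℤˣ) :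
    D.diff (chainPlus H μ) ⟨redden H N, σ⟩ =
      ∑ l, if N ∈ choices H (Function.update μ l (μ l + 1)) then
        (-1) ^ (∑ l' with l' < l, μ l') * ((1 - (-1) ^ (μ l + 1)) *
          if σ = minusAt (D.circleAt _ (H l).top) then 1 else 0) else 0 := by
  rw [chainPlus, diff_sum_single, sum_choices_incidence hg ho (fun _ => 1)]
  refine Finset.sum_congr rfl fun l _ => if_ctx_congr Iff.rfl (fun hN => ?_) fun _ => rfl
  have hN := mem_choices.mp hN
  have hl : (N l).card = μ l + 1 := by rw [hN, Function.update_self]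
  have hne (l') : (N l').Nonempty := by
    rw [← Finset.card_pos, hN, Function.update_apply]
    have := hμ l'
    split_ifs <;> omega
  rw [← hl, ← sum_step_telescope hp hg hne l fun c => if σ = minusAt c then 1 else 0]
  congr 1
  refine Finset.sum_congr rfl fun a ha => ?_
  congr 1
  obtain ⟨h1, h2⟩ := redden_eq_update hg ha
  -- The source has at least one red step in this ladder, so the target has two.
  have hb : D.IsBichord (redden H N) ((H l).crossing a) :=
    isBichord_step hg (by have := hμ l; omega) ha
  rw [← ite_or_eq_add fun h h' => hb (minusAt_injective (h.symm.trans h'))]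
  exact if_congr (adjacentAt_one_iff h1 h2 hb σ) rfl rfl

open Classical in
theorem diff_chainMinus_apply (hg : IsGrouping H) (ho : IsOrdered H) (i : Fin k) {ν : Fin k → ℕ}
    (hν : ∀ l, 1 ≤ ν l) (N : ∀ l, Finset (Fin (H l).height)) (σ : D.Circle (redden H N) → ℤˣ) :
    D.diff (chainMinus H i ν) ⟨redden H N, σ⟩ =
      ∑ l, if N ∈ choices H (Function.update ν l (ν l + 1)) then
        (-1) ^ (∑ l' with l' < l, ν l') * ((1 - (-1) ^ (ν l + 1)) *
          if D.circleAt (redden H N) (H l).top ≠ D.circleAt _ (H i).top ∧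
            σ = minusAt (D.circleAt _ (H l).top) * minusAt (D.circleAt _ (H i).top) then 1 else 0)
          else 0 := by
  rw [chainMinus_eq, diff_sum_single]
  simp only [reddenMinus_eq]
  rw [sum_choices_incidence hg ho]
  refine Finset.sum_congr rfl fun l _ => if_ctx_congr Iff.rfl (fun hN => ?_) fun _ => rfl
  have hN := mem_choices.mp hN
  have hl : (N l).card = ν l + 1 := by rw [hN, Function.update_self]
  have hne (l') : (N l').Nonempty := by
    rw [← Finset.card_pos, hN, Function.update_apply]
    have := hν l'
    split_ifs <;> omega
  rw [← hl, ← sum_step_telescope hp hg hne l fun c =>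
    if c ≠ D.circleAt _ (H i).top ∧ σ = minusAt c * minusAt (D.circleAt _ (H i).top) then 1 else 0]
  congr 1
  refine Finset.sum_congr rfl fun a ha => ?_
  congr 1
  obtain ⟨h1, h2⟩ := redden_eq_update hg ha
  have hb : D.IsBichord (redden H N) ((H l).crossing a) :=
    isBichord_step hg (by have := hν l; omega) ha
  rw [← ite_or_eq_add fun h h' =>
    hb (minusAt_injective (mul_right_cancel (h.2.symm.trans h'.2)))]
  exact if_congr (adjacentAt_minusAt_iff h1 h2 hb σ _) rfl rfl

end Chains

/-! ### The cycle, its double as a boundary, and its order. -/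

section Torsion

variable {X : Type*} [Fintype X] [LinearOrder X] {D : LinkDiagram X} {s₀ : KauffmanState X}
  {k : ℕ} {H : Fin k → Ladder D s₀}

omit [LinearOrder X] in
open Classical in
theorem chainMinus_apply (hg : IsGrouping H) (i : Fin k) (ν : Fin k → ℕ)
    (N : ∀ l, Finset (Fin (H l).height)) (σ : D.Circle (redden H N) → ℤˣ) :
    chainMinus H i ν ⟨redden H N, σ⟩ =
      if N ∈ choices H ν ∧ σ = minusAt (D.circleAt _ (H i).top) then 1 else 0 := by
  have hne (M : ∀ l, Finset (Fin (H l).height)) (hM : M ≠ N) :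
      Finsupp.single (reddenMinus H i M) (1 : ℤ) ⟨redden H N, σ⟩ = 0 :=
    Finsupp.single_eq_of_ne fun h => hM (redden_injective hg (congrArg Sigma.fst h).symm)
  rw [chainMinus_eq, Finsupp.finsetSum_apply]
  by_cases hN : N ∈ choices H ν
  · rw [Finset.sum_eq_single N (fun M _ hM => hne M hM) (absurd hN), reddenMinus_eq,
      Finsupp.single_apply]
    simp [hN, eq_comm]
  · rw [if_neg fun h => hN h.1]
    exact Finset.sum_eq_zero fun M hM => hne M fun h => hN (h ▸ hM)

omit [Fintype X] [LinearOrder X] in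
theorem chainMinus_apply_eq_zero (i : Fin k) (ν : Fin k → ℕ) {t : D.EnhancedState}
    (ht : ∀ N, t.1 ≠ redden H N) : chainMinus H i ν t = 0 := by
  rw [chainMinus_eq, Finsupp.finsetSum_apply]
  refine Finset.sum_eq_zero fun M _ => Finsupp.single_eq_of_ne ?_
  rintro rfl
  exact ht M rfl

omit [Fintype X] [LinearOrder X] in
theorem chainV_apply (μ : Fin k → ℕ) (t : D.EnhancedState) :
    chainV H μ t = ∑ i with Even (μ i) ∧ μ i < (H i).height,
      (-1 : ℤ) ^ (∑ l with l < i, μ l) * chainMinus H i (Function.update μ i (1 + μ i)) t := by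
  rw [chainV, Finsupp.finsetSum_apply]
  rfl

theorem diff_chainV_apply (μ : Fin k → ℕ) (t : D.EnhancedState) :
    D.diff (chainV H μ) t = ∑ i with Even (μ i) ∧ μ i < (H i).height,
      (-1 : ℤ) ^ (∑ l with l < i, μ l) *
        D.diff (chainMinus H i (Function.update μ i (1 + μ i))) t := by
  rw [chainV, map_sum, Finsupp.finsetSum_apply]
  refine Finset.sum_congr rfl fun i _ => ?_
  rw [map_smul]
  rfl

omit [Fintype X] [LinearOrder X] in
theorem card_le_height {ν : Fin k → ℕ} {N : ∀ l, Finset (Fin (H l).height)}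
    (hN : N ∈ choices H ν) (l : Fin k) : ν l ≤ (H l).height := by
  rw [← mem_choices.mp hN]
  simpa using Finset.card_le_univ (N l)

theorem one_sub_neg_one_pow_succ (n : ℕ) :
    1 - (-1 : ℤ) ^ (n + 1) = if Even n then 2 else 0 := by
  split_ifs with h
  · rw [h.add_one.neg_one_pow]
    norm_num
  · rw [(Nat.not_even_iff_odd.mp h).add_one.neg_one_pow]
    norm_num

/-- The telescoping factor is 2 exactly for even `μ l`. The condition `μ l < (H l).height` is
automatic whenever a choice of `μ l + 1` steps exists. -/
theorem diff_chainPlus (hp : ∀ l, peripheryNumber H l = 1) (hg : IsGrouping H)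
    (ho : IsOrdered H) {μ : Fin k → ℕ} (hμ : ∀ l, 1 ≤ μ l) :
    D.diff (chainPlus H μ) = (2 : ℤ) • chainV H μ := by
  classical
  ext t
  rw [Finsupp.smul_apply, smul_eq_mul, chainV_apply]
  by_cases ht : ∃ N, t.1 = redden H N
  swap
  · push Not at ht
    rw [chainPlus, diff_sum_single, Finset.sum_eq_zero fun M _ => incidence_eq_zero hg ht,
      Finset.sum_eq_zero fun i _ => by rw [chainMinus_apply_eq_zero i _ ht, mul_zero], mul_zero]
  obtain ⟨N, hN⟩ := ht
  obtain ⟨t, σ⟩ := t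
  obtain rfl : t = redden H N := hN
  rw [diff_chainPlus_apply hp hg ho hμ, Finset.sum_filter, Finset.mul_sum]
  refine Finset.sum_congr rfl fun l _ => ?_
  rw [chainMinus_apply hg, one_sub_neg_one_pow_succ, add_comm 1]
  by_cases hN : N ∈ choices H (Function.update μ l (μ l + 1))
  · have hl : μ l < (H l).height := by
      have := card_le_height hN l
      rwa [Function.update_self] at this
    by_cases he : Even (μ l)
    · simp only [hN, he, hl, if_true, true_and, and_self]
      ring
    · simp [he]
  · simp [hN]

/-- The coefficient at each state is a double sum over the ladder `i` raised in V and the ladder `l`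
raised by d. It is antisymmetric in `i` and `l`, so it vanishes. -/
theorem diff_chainV (hp : ∀ l, peripheryNumber H l = 1) (hg : IsGrouping H)
    (ho : IsOrdered H) {μ : Fin k → ℕ} (hμ : ∀ l, 1 ≤ μ l) :
    D.diff (chainV H μ) = 0 := by
  classical
  ext t
  rw [diff_chainV_apply, Finsupp.zero_apply]
  by_cases ht : ∃ N, t.1 = redden H N
  swap
  · push Not at ht
    refine Finset.sum_eq_zero fun i _ => ?_
    have h0 (M) : D.incidence (reddenMinus H i M) t = 0 := incidence_eq_zero hg ht
    rw [chainMinus_eq, diff_sum_single]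
    simp only [h0, Finset.sum_const_zero, mul_zero]
  obtain ⟨N, hN⟩ := ht
  obtain ⟨t, σ⟩ := t
  obtain rfl : t = redden H N := hN
  have hν (i l) : 1 ≤ Function.update μ i (1 + μ i) l := by
    have := hμ l
    rw [Function.update_apply]
    split_ifs <;> omega
  simp only [diff_chainMinus_apply hp hg ho _ (hν _), one_sub_neg_one_pow_succ, sum_lt_update]
  rw [Finset.sum_filter]
  set F : Fin k → Fin k → ℤ := fun i l => if Even (μ i) ∧ μ i < (H i).height then
    (-1 : ℤ) ^ (∑ l with l < i, μ l) *
      (if N ∈ choices H (Function.update (Function.update μ i (1 + μ i)) l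
          (Function.update μ i (1 + μ i) l + 1)) then
        (-1) ^ (∑ l' with l' < l, μ l' + if i < l then 1 else 0) *
          ((if Even (Function.update μ i (1 + μ i) l) then 2 else 0) *
            if D.circleAt (redden H N) (H l).top ≠ D.circleAt _ (H i).top ∧
              σ = minusAt (D.circleAt _ (H l).top) * minusAt (D.circleAt _ (H i).top)
            then 1 else 0) else 0) else 0 with hF
  suffices hsum : ∑ i, ∑ l, F i l = 0 by
    simpa only [hF, Finset.sum_ite_irrel, Finset.sum_const_zero, ← Finset.mul_sum] using hsum
  have hanti (i l) : F i l = -F l i := by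
    by_cases hil : i = l
    · subst hil
      simp [hF]
    by_cases hN : N ∈ choices H (Function.update (Function.update μ i (1 + μ i)) l
        (Function.update μ i (1 + μ i) l + 1))
    swap
    · have hN' := hN
      rw [update_add_one_symm μ hil] at hN'
      simp [hF, hN, hN']
    have hN' := hN
    rw [update_add_one_symm μ hil] at hN'
    have hl : μ l < (H l).height := by
      have := card_le_height hN l
      rwa [Function.update_self, Function.update_of_ne (Ne.symm hil)] at this
    have hi : μ i < (H i).height := by
      have := card_le_height hN' i
      rwa [Function.update_self, Function.update_of_ne hil] at this
    simp only [hF, hN, hN', hl, hi, if_true, and_true]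
    rw [Function.update_of_ne hil, Function.update_of_ne (Ne.symm hil),
      mul_comm (minusAt (D.circleAt (redden H N) (H i).top))]
    simp only [ne_comm (a := D.circleAt (redden H N) (H i).top)
      (b := D.circleAt (redden H N) (H l).top)]
    by_cases hei : Even (μ i) <;> by_cases hel : Even (μ l) <;> simp only [hei, hel, if_true,
      if_false, zero_mul, mul_zero, neg_zero]
    -- Both orders give the same two minus signs on circles; the extra red step of the earlier
    -- ladder contributes exactly one factor -1.
    rcases lt_or_gt_of_ne hil with h | h
    · rw [if_pos h, if_neg h.not_gt]
      ring
    · rw [if_pos h, if_neg h.not_gt]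
      ring
  have h2 : ∑ i, ∑ l, F i l = -∑ i, ∑ l, F i l := by
    conv_lhs => rw [Finset.sum_comm]
    simp only [← Finset.sum_neg_distrib]
    exact Finset.sum_congr rfl fun i _ => Finset.sum_congr rfl fun l _ => hanti l i
  omega

/-! ### Degrees -/

omit [LinearOrder X] in
theorem theta_one (s : KauffmanState X) : D.theta ⟨s, 1⟩ = D.numCircles s := by
  simp [theta, numCircles]

omit [LinearOrder X] in
theorem theta_minusAt {s : KauffmanState X} (c : D.Circle s) :
    D.theta ⟨s, minusAt c⟩ = D.numCircles s - 2 := by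
  classical
  have h : ∑ c', ((minusAt c c' : ℤˣ) : ℤ) - ∑ _c' : D.Circle s, (1 : ℤ) = -2 := by
    rw [← Finset.sum_sub_distrib, Finset.sum_eq_single c]
    · rw [minusAt_self]
      rfl
    · intro c' _ hc'
      rw [minusAt_of_ne hc']
      rfl
    · simp
  have h1 : ∑ _c' : D.Circle s, (1 : ℤ) = D.numCircles s := by simp [numCircles]
  rw [theta]
  linarith

theorem sum_update_one_add (μ : Fin k → ℕ) (i : Fin k) :
    ∑ l, Function.update μ i (1 + μ i) l = ∑ l, μ l + 1 := by
  rw [Finset.sum_update_of_mem (Finset.mem_univ i),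
    ← Finset.sum_sdiff (Finset.subset_univ {i}), Finset.sum_singleton]
  ring

theorem chainPlus_mem_chains (hp : ∀ l, peripheryNumber H l = 1) (hg : IsGrouping H)
    (c : ∀ l, Fin (H l).height) {μ : Fin k → ℕ} (hμ : ∀ l, 1 ≤ μ l) :
    chainPlus H μ ∈ D.chains (numRed s₀ + ∑ l, (μ l : ℤ))
      (numRed s₀ + D.numCircles (redden H fun l => {c l}) + 2 * ∑ l, (μ l : ℤ) - k) := by
  refine Submodule.sum_mem _ fun M hM => Finsupp.single_mem_supported _ _ ?_
  have hM := mem_choices.mp hM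
  have h1 := numRed_redden hg M
  have h2 := numCircles_redden hp hg c M fun l => Finset.card_pos.mp (by rw [hM]; exact hμ l)
  simp only [hM] at h1 h2
  zify at h1 h2
  simp only [Set.mem_ofPred_eq, jDeg, iDeg, theta_one]
  constructor <;> linarith

/-- Compared with `chainPlus`, the extra red step adds one to the number of red scars and one to the
number of circles, and the minus sign lowers `theta` by two: j is unchanged. -/
theorem chainMinus_mem_chains (hp : ∀ l, peripheryNumber H l = 1) (hg : IsGrouping H)
    (c : ∀ l, Fin (H l).height) {μ : Fin k → ℕ} (hμ : ∀ l, 1 ≤ μ l) (i : Fin k) :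
    chainMinus H i (Function.update μ i (1 + μ i)) ∈
      D.chains (numRed s₀ + 1 + ∑ l, (μ l : ℤ))
      (numRed s₀ + D.numCircles (redden H fun l => {c l}) + 2 * ∑ l, (μ l : ℤ) - k) := by
  refine Submodule.sum_mem _ fun M hM => Finsupp.single_mem_supported _ _ ?_
  have hM := mem_choices.mp hM
  have h1 := numRed_redden hg M
  have h2 := numCircles_redden hp hg c M fun l => Finset.card_pos.mp (by
    rw [hM, Function.update_apply]
    have := hμ l
    split_ifs <;> omega)
  simp only [hM] at h1 h2
  rw [sum_update_one_add] at h1 h2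
  zify at h1 h2
  rw [Set.mem_ofPred_eq, reddenMinus_eq]
  simp only [jDeg, iDeg, theta_minusAt]
  constructor <;> linarith

theorem chainV_mem_chains (hp : ∀ l, peripheryNumber H l = 1) (hg : IsGrouping H)
    (c : ∀ l, Fin (H l).height) {μ : Fin k → ℕ} (hμ : ∀ l, 1 ≤ μ l) :
    chainV H μ ∈ D.chains (numRed s₀ + 1 + ∑ l, (μ l : ℤ))
      (numRed s₀ + D.numCircles (redden H fun l => {c l}) + 2 * ∑ l, (μ l : ℤ) - k) :=
  Submodule.sum_mem _ fun i _ => Submodule.smul_mem _ _ (chainMinus_mem_chains hp hg c hμ i)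

omit [Fintype X] [LinearOrder X] in
theorem choices_nonempty {ν : Fin k → ℕ} (hν : ∀ l, ν l ≤ (H l).height) :
    (choices H ν).Nonempty := by
  rw [choices, Fintype.piFinset_nonempty]
  intro l
  rw [Finset.powersetCard_nonempty]
  simpa using hν l

/-- The parity functional is applied at a state `N` with `1 + μ r` red steps in ladder `r` and `μ l`
in the others. The numbers of steps rule out every summand of V but the `r`-th, which contributes a
single ±1. -/
theorem diff_ne_chainV (hp : ∀ l, peripheryNumber H l = 1) (hg : IsGrouping H)
    {c : ∀ l, Fin (H l).height}
    (hb : ∀ x, s₀ x = Label.B → D.IsBichord (redden H fun l => {c l}) x)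
    {μ : Fin k → ℕ} (hμ : ∀ l, 2 ≤ μ l ∧ μ l ≤ (H l).height) {r : Fin k}
    (hr : Even (μ r) ∧ μ r < (H r).height) (z : D.Chain) : D.diff z ≠ chainV H μ := by
  classical
  intro hz
  obtain ⟨N, hN⟩ := choices_nonempty (H := H) (ν := Function.update μ r (1 + μ r)) fun l => by
    by_cases hl : l = r
    · subst hl
      rw [Function.update_self]
      omega
    · rw [Function.update_of_ne hl]
      exact (hμ l).2
  -- This is where `2 ≤ μ l` matters: it makes all red scars bichords.
  have hcard (l) : 2 ≤ (N l).card := by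
    rw [mem_choices.mp hN, Function.update_apply]
    have := (hμ l).1
    have := (hμ r).1
    split_ifs <;> omega
  have heven := even_sum_diff (t := redden H N) (fun x hx => isBichord_redden hp hg hb hcard hx) z
  rw [hz] at heven
  have hsum : ∑ e, chainV H μ ⟨redden H N, minusAt e⟩ = (-1) ^ (∑ l with l < r, μ l) := by
    rw [Finset.sum_eq_single (D.circleAt _ (H r).top)]
    · rw [chainV_apply, Finset.sum_eq_single r]
      · simp [chainMinus_apply hg, hN]
      · intro i _ hi
        rw [chainMinus_apply hg, if_neg, mul_zero]
        rintro ⟨h, -⟩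
        have h1 := mem_choices.mp h r
        rw [mem_choices.mp hN, Function.update_self, Function.update_of_ne hi.symm] at h1
        omega
      · intro h
        simp [hr] at h
    · intro e _ he
      rw [chainV_apply]
      refine Finset.sum_eq_zero fun i _ => ?_
      rw [chainMinus_apply hg, if_neg, mul_zero]
      rintro ⟨h, h'⟩
      have hi : i = r := by
        by_contra hi
        have h1 := mem_choices.mp h i
        rw [mem_choices.mp hN, Function.update_self, Function.update_of_ne hi] at h1
        omega
      subst hi
      exact he (minusAt_injective h')
    · simp
  rw [hsum] at heven
  rcases neg_one_pow_eq_or ℤ (∑ l with l < r, μ l) with h | h <;> rw [h] at heven <;>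
    revert heven <;> decide

theorem addOrderOf_homologyClass_chainV
    (hg : IsGrouping H) (ho : IsOrdered H) (hp : ∀ l, peripheryNumber H l = 1)
    {c : ∀ l, Fin (H l).height}
    (hb : ∀ x, s₀ x = Label.B → D.IsBichord (redden H fun l => {c l}) x)
    {μ : Fin k → ℕ} (hμ : ∀ l, 2 ≤ μ l ∧ μ l ≤ (H l).height)
    (hr : ∃ r, Even (μ r) ∧ μ r < (H r).height) {i j : ℤ}
    (hi : i = numRed s₀ + 1 + ∑ l, (μ l : ℤ))
    (hj : j = numRed s₀ + D.numCircles (redden H fun l => {c l}) + 2 * ∑ l, (μ l : ℤ) - k) :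
    ∃ hV : chainV H μ ∈ D.cycles i j, addOrderOf (D.homologyClass ⟨chainV H μ, hV⟩) = 2 := by
  have hμ' (l) : 1 ≤ μ l := one_le_two.trans (hμ l).1
  obtain ⟨r, hr⟩ := hr
  have hV : chainV H μ ∈ D.cycles i j := by
    subst hi hj
    exact ⟨chainV_mem_chains hp hg c hμ', diff_chainV hp hg ho hμ'⟩
  refine ⟨hV, addOrderOf_eq_prime ?_ ?_⟩
  · refine (Submodule.Quotient.mk_eq_zero _).mpr ?_
    refine ⟨chainPlus H μ, ?_, ?_⟩
    · have : i - 1 = numRed s₀ + ∑ l, (μ l : ℤ) := by rw [hi]; ring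
      rw [this, hj]
      exact chainPlus_mem_chains hp hg c hμ'
    · rw [diff_chainPlus hp hg ho hμ', two_smul]
      exact (congrArg Subtype.val (two_nsmul (⟨chainV H μ, hV⟩ : D.cycles i j))).symm
  · intro h
    obtain ⟨z, -, hz⟩ := (Submodule.Quotient.mk_eq_zero _).mp h
    exact diff_ne_chainV hp hg hb hμ hr z hz

end Torsion

end LinkDiagram

end KhovanovLadders

/-! ### Conclusion for the oriented link. -/

theorem theorem5p1 {X : Type*} [Fintype X] [LinearOrder X]
    (D : KhovanovLadders.LinkDiagram X) (o : D.Orientation)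
    (s₀ : KhovanovLadders.KauffmanState X) {k : ℕ}
    (H : Fin k → KhovanovLadders.LinkDiagram.Ladder D s₀)
    (hgroup : KhovanovLadders.LinkDiagram.IsGrouping H)
    (hord : KhovanovLadders.LinkDiagram.IsOrdered H)
    (hheight : ∀ i, 2 ≤ (H i).height)
    (hperiphery : ∀ i, KhovanovLadders.LinkDiagram.peripheryNumber H i = 1)
    (hlarge : ∃ l, 3 ≤ (H l).height)
    -- `s₁` is obtained from `s₀` by changing into red one blue step of each ladder
    (c : ∀ i, Fin (H i).height) (s₁ : KhovanovLadders.KauffmanState X)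
    (hs₁ : s₁ = KhovanovLadders.LinkDiagram.redden H fun i => {c i})
    (hbichord : ∀ x, s₀ x = KhovanovLadders.Label.B → D.IsBichord s₁ x) :
    (∃ (h q : ℤ) (ξ : D.KhLink o h q), addOrderOf ξ = 2) ∧
    ∀ μ : Fin k → ℕ, (∀ i, 2 ≤ μ i ∧ μ i ≤ (H i).height) →
      (∃ r, Even (μ r) ∧ μ r < (H r).height) →
      ∀ i j : ℤ,
        i = (KhovanovLadders.numRed s₀ : ℤ) + 1 + ∑ l, (μ l : ℤ) →
        j = (KhovanovLadders.numRed s₀ : ℤ) + D.numCircles s₁ + 2 * ∑ l, (μ l : ℤ) - k →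
        ∃ hV : KhovanovLadders.LinkDiagram.chainV H μ ∈ D.cycles i j,
          addOrderOf (D.homologyClass ⟨KhovanovLadders.LinkDiagram.chainV H μ, hV⟩) = 2 := by
  subst hs₁
  have main {μ : Fin k → ℕ} (hμ : ∀ i, 2 ≤ μ i ∧ μ i ≤ (H i).height)
      (hr : ∃ r, Even (μ r) ∧ μ r < (H r).height) {i j : ℤ} :=
    KhovanovLadders.LinkDiagram.addOrderOf_homologyClass_chainV (i := i) (j := j) hgroup hord
      hperiphery hbichord hμ hr
  refine ⟨?_, fun μ hμ hr i j hi hj => main hμ hr hi hj⟩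
  obtain ⟨l, hl⟩ := hlarge
  -- The constant choice 2 is even and at most every height; the ladder of height at least 3 serves
  -- as `r`.
  obtain ⟨hV, h⟩ := main (μ := fun _ => 2) (fun i => ⟨le_rfl, hheight i⟩) ⟨l, even_two, hl⟩ rfl rfl
  generalize D.homologyClass ⟨_, hV⟩ = ξ at h
  revert ξ
  generalize (KhovanovLadders.numRed s₀ : ℤ) + 1 + _ = i
  generalize (KhovanovLadders.numRed s₀ : ℤ) + _ + _ - _ = j
  intro ξ h
  -- The degree shift of the orientation is a bijection, so any (i, j) comes from some (h, q).
  obtain ⟨i, rfl⟩ : ∃ i', i = i' + (o.numNeg : ℤ) := ⟨i - o.numNeg, by ring⟩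
  obtain ⟨j, rfl⟩ : ∃ j', j = j' - (o.numPos : ℤ) + 2 * o.numNeg :=
    ⟨j + o.numPos - 2 * o.numNeg, by ring⟩
  exact ⟨i, j, ξ, h⟩
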